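/- Let $m\ge 1$ and, for $j=1,\dots,m$, let $(Y^{(j)}_n)_{n\ge1}$ be i.i.d. random variables with values in $\mathbb N=\{1,2,\dots\}$, the $m$ sequences being independent of each other. Write $S^{(j)}_0=0$, $S^{(j)}_n=Y^{(j)}_1+\dots+Y^{(j)}_n$ for the corresponding renewal processes, $p^{(j)}_n=\mathbb P(Y^{(j)}_1=n)$ and $\overline F^{(j)}(n)=\mathbb P(Y^{(j)}_1>n)$. Assume that for every $j$: - the law of $Y^{(j)}_1$ is aperiodic, i.e. $\gcd\{n\ge1: p^{(j)}_n>0\}=1$; - $\overline F^{(j)}(n)=n^{-\beta_j}L_j(n)$ for all $n\ge1$, where $\beta_j\in(0,1)$ and $L_j$ is slowly varying at infinity, i.e. $L_j$ is eventually positive and $L_j(\lfloor cn\rfloor)/L_j(n)\to1$ as $n\to\infty$ for every $c>0$; - (Doney's condition) $\sup_{n\ge1} n\,p^{(j)}_n/\overline F^{(j)}(n)<\infty$. Assume moreover that $\beta^*:=\sum_{q=1}^m\beta_q-m+1\in(0,1)$. Let the intersection renewal process be the process of simultaneous renewal times of the $m$ processes; its inter-renewal times $Y^*_1,Y^*_2,\dots$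 are given by $$Y^*_{k+1}=\min\{\ell\in\mathbb N:\ \text{for every } j \text{ there is } n_j\in\mathbb N \text{ with } Y_1^*+\dots+Y_k^*+\ell=S^{(j)}_{n_j}\},\qquad k\ge0,$$ with $\min\emptyset=\infty$. Then its tail $\overline{F^*}(n):=\mathbb P(Y^*_1>n)$ satisfies, as $n\to\infty$, $$\overline{F^*}(n)\sim n^{-\beta^*}L^*(n)\quad\text{with}\quad L^*(n)=\frac{\prod_{q=1}^m\left[\Gamma(\beta_q)\Gamma(1-\beta_q)L_q(n)\right]}{\Gamma(\beta^*)\Gamma(1-\beta^*)}.$$ -/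

import Mathlib

open MeasureTheory ProbabilityTheory Filter Topology Asymptotics

noncomputable section

namespace Renewal

/-- A sequence `L : ℕ → ℝ` is slowly varying at infinity: it is eventually positive and
`L ⌊c n⌋ / L n → 1` as `n → ∞`, for every real `c > 0`. -/
structure SlowlyVarying (L : ℕ → ℝ) : Prop where
  eventually_pos : ∀ᶠ n in atTop, 0 < L n
  tendsto_ratio : ∀ c : ℝ, 0 < c →
    Tendsto (fun n : ℕ => L ⌊c * (n : ℝ)⌋₊ / L n) atTop (𝓝 1)

variable {Ω : Type*} [MeasurableSpace Ω]

/-- `Y 0, Y 1, Y 2, …` are the inter-renewal times (usually written `Y₁, Y₂, Y₃, …`) of a renewal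
process with values in `{1, 2, …}`: they are independent and identically distributed random
variables with values in the positive integers. -/
structure IsRenewalProcess (μ : Measure Ω) (Y : ℕ → Ω → ℕ) : Prop where
  measurable : ∀ i, Measurable (Y i)
  pos : ∀ i ω, 1 ≤ Y i ω
  indep : iIndepFun Y μ
  identDistrib : ∀ i, IdentDistrib (Y i) (Y 0) μ μ

/-- The renewal times `S₀ = 0`, `Sₙ = Y₁ + ⋯ + Yₙ`. -/
def renewalTime (Y : ℕ → Ω → ℕ) (n : ℕ) (ω : Ω) : ℕ := ∑ i ∈ Finset.range n, Y i ω

/-- The tail `F̄(n) = ℙ(Y₁ > n)` of the inter-renewal times. -/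
def tail (μ : Measure Ω) (Y : ℕ → Ω → ℕ) (n : ℕ) : ℝ := μ.real {ω | n < Y 0 ω}

/-- The probability mass function `pₙ = ℙ(Y₁ = n)` of the inter-renewal times. -/
def mass (μ : Measure Ω) (Y : ℕ → Ω → ℕ) (n : ℕ) : ℝ := μ.real {ω | Y 0 ω = n}

/-- The law of the inter-renewal times is aperiodic: the greatest common divisor of
`{n | pₙ > 0}` is `1`. -/
def Aperiodic (μ : Measure Ω) (Y : ℕ → Ω → ℕ) : Prop :=
  ∀ d : ℕ, (∀ n : ℕ, 0 < mass μ Y n → d ∣ n) → d = 1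

/-- Doney's condition `sup_{n ≥ 1} n pₙ / F̄(n) < ∞` (the term at `n = 0` vanishes). -/
def DoneyCondition (μ : Measure Ω) (Y : ℕ → Ω → ℕ) : Prop :=
  BddAbove (Set.range fun n : ℕ => (n : ℝ) * mass μ Y n / tail μ Y n)

variable {m : ℕ}

/-- The set of positive integers that are renewal times of all `m` processes. -/
def commonRenewals (Y : Fin m → ℕ → Ω → ℕ) (ω : Ω) : Set ℕ :=
  {t | 1 ≤ t ∧ ∀ k : Fin m, ∃ n : ℕ, 1 ≤ n ∧ t = renewalTime (Y k) n ω}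

/-- The waiting time from `t` to the next simultaneous renewal: the least `l ≥ 1` such that
`t + l` is a renewal time of all processes, and `∞` if there is no such `l`. -/
def nextGap (Y : Fin m → ℕ → Ω → ℕ) (ω : Ω) (t : ℕ∞) : ℕ∞ :=
  sInf {x : ℕ∞ | ∃ l : ℕ, x = (l : ℕ∞) ∧ 1 ≤ l ∧
    ∃ s ∈ commonRenewals Y ω, (s : ℕ∞) = t + (l : ℕ∞)}

/-- The renewal times of the intersection renewal process (`0`, then the successive
simultaneous renewal times). -/
def interTime (Y : Fin m → ℕ → Ω → ℕ) (ω : Ω) : ℕ → ℕ∞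
  | 0 => 0
  | k + 1 => interTime Y ω k + nextGap Y ω (interTime Y ω k)

/-- The inter-renewal times of the intersection renewal process; `interGap Y k` is
`Y*₍ₖ₊₁₎`, so that `interGap Y 0` is `Y*₁`. -/
def interGap (Y : Fin m → ℕ → Ω → ℕ) (k : ℕ) (ω : Ω) : ℕ∞ :=
  nextGap Y ω (interTime Y ω k)

/-- The tail `F̄*(n) = ℙ(Y*₁ > n)` of the intersection renewal process. -/
def interTail (μ : Measure Ω) (Y : Fin m → ℕ → Ω → ℕ) (n : ℕ) : ℝ :=
  μ.real {ω | (n : ℕ∞) < interGap Y 0 ω}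

/-- The exponent `β* = β₁ + ⋯ + βₘ - m + 1`. -/
def betaStar (β : Fin m → ℝ) : ℝ := ∑ q, β q - (m : ℝ) + 1

/-- The function
`L*(n) = ∏_q [Γ(β_q) Γ(1 - β_q) L_q(n)] / (Γ(β*) Γ(1 - β*))`. -/
def LStar (β : Fin m → ℝ) (L : Fin m → ℕ → ℝ) (n : ℕ) : ℝ :=
  (∏ q, Real.Gamma (β q) * Real.Gamma (1 - β q) * L q n) /
    (Real.Gamma (betaStar β) * Real.Gamma (1 - betaStar β))

end Renewal

end

/-
Let `uⱼ(n)` be the probability that `n` is a renewal time of the `j`-th process. Doney's strong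
renewal theorem gives `n F̄ⱼ(n) uⱼ(n) → 1 / (Γ(βⱼ) Γ(1 - βⱼ))`. It is proved by Fourier inversion:
with `P` the generating function of `p`, the generating function `1 / (1 - P)` of `u` need not be
integrable enough on the circle, so one works with `(1 - P)⁻¹ (ε + 1 - P)⁻¹ ^ M` for large `M` and
`ε = F̄(n) / δ`; after rescaling, dominated convergence applies, and Doney's condition bounds the
error made by these extra factors as `δ → 0`. The limit is only shown to exist this way; its value
is forced by `u * F̄ = 1`.

By independence the intersection process renews at `n` with probability `u(n) = ∏ⱼ uⱼ(n)`, so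
`n g(n) u(n) → 1` for a regularly varying `g` of index `-β*`. Splitting at the last common renewal
gives `u * F̄* = 1`, and since `F̄*` is monotone a Tauberian argument recovers `F̄*` from `u`:
`u * g → Γ(β*) Γ(1 - β*)`, so convolving `u * F̄* = 1` with `g` shows that the partial sums of `F̄*`
are asymptotically `1 / (Γ(β*) Γ(1 - β*))` times those of `g`, and monotone density concludes.
-/

namespace Renewal

theorem exists_two_pow_mul_le_lt {m n : ℕ} (hm : 1 ≤ m) (hmn : m ≤ n) :
    ∃ k : ℕ, 2 ^ k * m ≤ n ∧ n < 2 ^ (k + 1) * m :=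
  ⟨Nat.log 2 (n / m),
    (Nat.le_div_iff_mul_le hm).1 (Nat.pow_log_le_self 2 (Nat.div_pos hmn hm).ne'),
    (Nat.div_lt_iff_lt_mul hm).1 (Nat.lt_pow_succ_log_self (by norm_num) _)⟩

theorem tendsto_floor_mul_div {x : ℝ} (hx : 0 ≤ x) :
    Tendsto (fun n : ℕ => (⌊(n : ℝ) * x⌋₊ : ℝ) / n) atTop (𝓝 x) :=
  ((tendsto_nat_floor_mul_div_atTop (R := ℝ) hx).comp tendsto_natCast_atTop_atTop).congr
    fun n => by simp [mul_comm]

theorem tendsto_floor_mul_atTop {x : ℝ} (hx : 0 < x) :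
    Tendsto (fun n : ℕ => ⌊(n : ℝ) * x⌋₊) atTop atTop :=
  tendsto_nat_floor_atTop.comp (tendsto_natCast_atTop_atTop.atTop_mul_const hx)

/-- The filter of pairs `(k, n)` with `n → ∞` and `k / n → y`. -/
noncomputable def ratioFilter (y : ℝ) : Filter (ℕ × ℕ) :=
  comap (fun p => ((p.1 : ℝ) / p.2, p.2)) (𝓝 y ×ˢ atTop)

section RatioFilter

variable {y : ℝ}

theorem tendsto_ratioFilter {ι : Type*} {l : Filter ι} {k n : ι → ℕ} (hn : Tendsto n l atTop)
    (hk : Tendsto (fun i => (k i : ℝ) / n i) l (𝓝 y)) :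
    Tendsto (fun i => (k i, n i)) l (ratioFilter y) :=
  tendsto_comap_iff.2 (hk.prodMk hn)

theorem tendsto_div_ratioFilter :
    Tendsto (fun p : ℕ × ℕ => (p.1 : ℝ) / p.2) (ratioFilter y) (𝓝 y) :=
  tendsto_fst.comp tendsto_comap

theorem tendsto_snd_ratioFilter : Tendsto Prod.snd (ratioFilter y) atTop :=
  (tendsto_snd (f := 𝓝 y)).comp (g := Prod.snd) tendsto_comap

theorem eventually_one_le_ratioFilter (hy : 0 < y) :
    ∀ᶠ p in ratioFilter y, 1 ≤ p.1 ∧ 1 ≤ p.2 := by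
  filter_upwards [tendsto_div_ratioFilter.eventually_const_lt hy,
    tendsto_snd_ratioFilter.eventually_ge_atTop 1] with p hp hp2
  refine ⟨Nat.one_le_iff_ne_zero.2 fun h => ?_, hp2⟩
  simp [h] at hp

theorem tendsto_floor_mul_ratioFilter (hy : 0 ≤ y) :
    Tendsto (fun n : ℕ => (⌊(n : ℝ) * y⌋₊, n)) atTop (ratioFilter y) :=
  tendsto_ratioFilter tendsto_id (tendsto_floor_mul_div hy)

theorem tendsto_mul_ratioFilter (c : ℕ) :
    Tendsto (fun n : ℕ => (c * n, n)) atTop (ratioFilter c) := by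
  refine tendsto_ratioFilter tendsto_id (tendsto_const_nhds.congr' ?_)
  filter_upwards [eventually_ge_atTop 1] with n hn
  have : (n : ℝ) ≠ 0 := by positivity
  push_cast
  field_simp

end RatioFilter

/-- `g` is regularly varying of index `ρ`. The convergence of the ratios is required to be
continuous, that is `g (k n) / g n → y ^ ρ` whenever `k n / n → y > 0`; for functions of a real
variable this is the uniform convergence theorem. The value at `0` is unconstrained. -/
structure RegularlyVarying (ρ : ℝ) (g : ℕ → ℝ) : Prop where
  pos : ∀ n, 1 ≤ n → 0 < g n
  tendsto_ratio : ∀ y : ℝ, 0 < y →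
    Tendsto (fun p : ℕ × ℕ => g p.1 / g p.2) (ratioFilter y) (𝓝 (y ^ ρ))

namespace RegularlyVarying

variable {ρ σ : ℝ} {f g : ℕ → ℝ}

theorem congr (h : RegularlyVarying ρ f) (hρ : ρ = σ) (hfg : ∀ n, 1 ≤ n → f n = g n) :
    RegularlyVarying σ g where
  pos n hn := hfg n hn ▸ h.pos n hn
  tendsto_ratio y hy := by
    refine (hρ ▸ h.tendsto_ratio y hy).congr' ?_
    filter_upwards [eventually_one_le_ratioFilter hy] with p hp
    rw [hfg _ hp.1, hfg _ hp.2]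

theorem mul (hf : RegularlyVarying ρ f) (hg : RegularlyVarying σ g) :
    RegularlyVarying (ρ + σ) (fun n => f n * g n) where
  pos n hn := mul_pos (hf.pos n hn) (hg.pos n hn)
  tendsto_ratio y hy := by
    rw [Real.rpow_add hy]
    exact ((hf.tendsto_ratio y hy).mul (hg.tendsto_ratio y hy)).congr fun p =>
      (mul_div_mul_comm _ _ _ _).symm

theorem inv (h : RegularlyVarying ρ g) : RegularlyVarying (-ρ) (fun n => (g n)⁻¹) where
  pos n hn := inv_pos.2 (h.pos n hn)
  tendsto_ratio y hy := by
    rw [Real.rpow_neg hy.le]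
    exact ((h.tendsto_ratio y hy).inv₀ (Real.rpow_pos_of_pos hy _).ne').congr fun p =>
      by rw [inv_div_inv, inv_div]

theorem const_mul {c : ℝ} (hc : 0 < c) (h : RegularlyVarying ρ g) :
    RegularlyVarying ρ (fun n => c * g n) where
  pos n hn := mul_pos hc (h.pos n hn)
  tendsto_ratio y hy :=
    (h.tendsto_ratio y hy).congr fun _ => (mul_div_mul_left _ _ hc.ne').symm

theorem rpow (s : ℝ) : RegularlyVarying s (fun n => (n : ℝ) ^ s) where
  pos n hn := Real.rpow_pos_of_pos (by exact_mod_cast hn) _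
  tendsto_ratio y hy :=
    (tendsto_div_ratioFilter.rpow_const (Or.inl hy.ne')).congr fun p =>
      Real.div_rpow (Nat.cast_nonneg _) (Nat.cast_nonneg _) _

theorem one : RegularlyVarying 0 (fun _ => 1) :=
  (rpow 0).congr rfl fun _ _ => Real.rpow_zero _

theorem inv_natCast_mul (h : RegularlyVarying ρ g) :
    RegularlyVarying (-(1 + ρ)) (fun n : ℕ => (n * g n)⁻¹) :=
  ((rpow 1).mul h).inv.congr rfl fun n _ => by simp only [Real.rpow_one]

theorem prod {ι : Type*} (s : Finset ι) {ρ : ι → ℝ} {g : ι → ℕ → ℝ}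
    (h : ∀ i ∈ s, RegularlyVarying (ρ i) (g i)) :
    RegularlyVarying (∑ i ∈ s, ρ i) (fun n => ∏ i ∈ s, g i n) := by
  classical
  induction s using Finset.induction_on with
  | empty => simpa using one
  | insert a s ha ih =>
    simp only [Finset.sum_insert ha, Finset.prod_insert ha]
    exact (h a (Finset.mem_insert_self _ _)).mul
      (ih fun i hi => h i (Finset.mem_insert_of_mem hi))

theorem exists_le_mul_of_div_mem_Icc (h : RegularlyVarying ρ g) :
    ∃ K : ℝ, 0 ≤ K ∧
      ∃ N : ℕ, ∀ k n : ℕ, N ≤ n → (k : ℝ) / n ∈ Set.Icc 1 2 → g k ≤ K * g n := by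
  refine isCompact_Icc.induction_on
    (p := fun s : Set ℝ => ∃ K : ℝ, 0 ≤ K ∧
      ∃ N : ℕ, ∀ k n : ℕ, N ≤ n → (k : ℝ) / n ∈ s → g k ≤ K * g n) ?_ ?_ ?_ ?_
  · exact ⟨0, le_rfl, 0, fun k n _ hk => hk.elim⟩
  · rintro s t hst ⟨K, hK, N, hN⟩
    exact ⟨K, hK, N, fun k n hn hk => hN k n hn (hst hk)⟩
  · rintro s t ⟨K, hK, N, hN⟩ ⟨K', _, N', hN'⟩
    refine ⟨max K K', hK.trans (le_max_left _ _), max (max N N') 1, fun k n hn hk => ?_⟩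
    simp only [max_le_iff] at hn
    have hgn := (h.pos n hn.2).le
    rcases hk with hk | hk
    · exact (hN k n hn.1.1 hk).trans (mul_le_mul_of_nonneg_right (le_max_left _ _) hgn)
    · exact (hN' k n hn.1.2 hk).trans (mul_le_mul_of_nonneg_right (le_max_right _ _) hgn)
  · intro y hy
    have hy0 : 0 < y := one_pos.trans_le hy.1
    have hev : ∀ᶠ p in ratioFilter y, g p.1 ≤ (y ^ ρ + 1) * g p.2 := by
      filter_upwards [(h.tendsto_ratio y hy0).eventually_le_const (lt_add_one _),
        eventually_one_le_ratioFilter hy0] with p hp hp1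
      exact (div_le_iff₀ (h.pos _ hp1.2)).1 hp
    obtain ⟨u, hu, v, hv, huv⟩ := mem_prod_iff.1 (mem_comap.1 hev).choose_spec.1
    obtain ⟨N, hN⟩ := mem_atTop_sets.1 hv
    exact ⟨u, mem_nhdsWithin_of_mem_nhds hu, y ^ ρ + 1, by positivity, N, fun k n hn hk =>
      (mem_comap.1 hev).choose_spec.2 (show (k, n) ∈ _ from huv ⟨hk, hN n hn⟩)⟩

theorem eventually_le_of_neg (h : RegularlyVarying ρ g) (hρ : ρ < 0) :
    ∃ K : ℝ, 0 < K ∧ ∃ N : ℕ, 1 ≤ N ∧ ∀ m n : ℕ, N ≤ m → m ≤ n → g n ≤ K * g m := by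
  obtain ⟨K, hK, N, hN⟩ := h.exists_le_mul_of_div_mem_Icc
  have hdouble : ∀ᶠ n in atTop, g (2 * n) ≤ g n := by
    have hlim : Tendsto (fun n => g (2 * n) / g n) atTop (𝓝 ((2 : ℕ) ^ ρ)) :=
      (h.tendsto_ratio (2 : ℕ) (by norm_num)).comp (tendsto_mul_ratioFilter 2)
    have hlt : ((2 : ℕ) : ℝ) ^ ρ < 1 := Real.rpow_lt_one_of_one_lt_of_neg (by norm_num) hρ
    filter_upwards [hlim.eventually_le_const hlt, eventually_ge_atTop 1] with n hn hn1
    exact (div_le_one (h.pos n hn1)).1 hn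
  obtain ⟨N', hN'⟩ := eventually_atTop.1 hdouble
  have hiter : ∀ k m, N' ≤ m → g (2 ^ k * m) ≤ g m := by
    intro k m hm
    induction k with
    | zero => simp
    | succ k ih =>
      rw [pow_succ', mul_assoc]
      exact (hN' _ (hm.trans (Nat.le_mul_of_pos_left _ (by positivity)))).trans ih
  refine ⟨K + 1, by positivity, max (max N N') 1, le_max_right _ _, fun m n hm hmn => ?_⟩
  simp only [max_le_iff] at hm
  obtain ⟨⟨hmN, hmN'⟩, hm1⟩ := hm
  obtain ⟨k, hk, hk'⟩ := exists_two_pow_mul_le_lt hm1 hmn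
  have hq : (0 : ℝ) < (2 ^ k * m : ℕ) := by exact_mod_cast Nat.mul_pos (by positivity) hm1
  have hratio : (n : ℝ) / (2 ^ k * m : ℕ) ∈ Set.Icc 1 2 := by
    rw [Set.mem_Icc, one_le_div hq, div_le_iff₀ hq]
    exact ⟨by exact_mod_cast hk, by exact_mod_cast (by rw [← mul_assoc, ← pow_succ']; exact hk'.le)⟩
  have hgm := (h.pos m hm1).le
  calc g n ≤ K * g (2 ^ k * m) :=
        hN _ _ (hmN.trans (Nat.le_mul_of_pos_left _ (by positivity))) hratio
    _ ≤ K * g m := mul_le_mul_of_nonneg_left (hiter k m hmN') hK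
    _ ≤ (K + 1) * g m := by gcongr; linarith

theorem exists_le_mul_of_neg (h : RegularlyVarying ρ g) (hρ : ρ < 0) :
    ∃ C : ℝ, 0 < C ∧ ∀ m n : ℕ, 1 ≤ m → m ≤ n → g n ≤ C * g m := by
  obtain ⟨K, hK, N, hN1, hN⟩ := h.eventually_le_of_neg hρ
  obtain ⟨D, hD⟩ := ((Finset.Icc 1 N ×ˢ Finset.Icc 1 N).image fun p => g p.1 / g p.2).exists_le
  have hinitial : ∀ m n, 1 ≤ m → m ≤ N → 1 ≤ n → n ≤ N → g n ≤ D * g m := by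
    intro m n hm hmN hn hnN
    have := hD _ (Finset.mem_image_of_mem _ (Finset.mk_mem_product
      (Finset.mem_Icc.2 ⟨hn, hnN⟩) (Finset.mem_Icc.2 ⟨hm, hmN⟩)))
    exact (div_le_iff₀ (h.pos m hm)).1 this
  have hD1 : 1 ≤ D := by
    nlinarith [hinitial N N hN1 le_rfl hN1 le_rfl, h.pos N hN1]
  refine ⟨(K + 1) * D, by positivity, fun m n hm hmn => ?_⟩
  have hgm := (h.pos m hm).le
  have hKD : K ≤ (K + 1) * D := by nlinarith
  rcases le_total N m with hm' | hm'
  · exact (hN m n hm' hmn).trans (mul_le_mul_of_nonneg_right hKD hgm)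
  rcases le_total N n with hn' | hn'
  · calc g n ≤ K * g N := hN N n le_rfl hn'
      _ ≤ K * (D * g m) := by gcongr; exact hinitial m N hm hm' hN1 le_rfl
      _ ≤ (K + 1) * D * g m := by rw [mul_assoc]; gcongr; linarith
  · refine (hinitial m n hm hm' (hm.trans hmn) hn').trans (mul_le_mul_of_nonneg_right ?_ hgm)
    nlinarith

theorem potter_upper (h : RegularlyVarying ρ g) (hσ : ρ < σ) :
    ∃ C : ℝ, 0 < C ∧ ∀ m n : ℕ, 1 ≤ m → m ≤ n → g n ≤ C * g m * ((n : ℝ) / m) ^ σ := by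
  obtain ⟨C, hC, hle⟩ := (h.mul (rpow (-σ))).exists_le_mul_of_neg (by linarith)
  refine ⟨C, hC, fun m n hm hmn => ?_⟩
  have hm0 : (0 : ℝ) < m := by exact_mod_cast hm
  have hn0 : (0 : ℝ) < n := by exact_mod_cast hm.trans hmn
  have := hle m n hm hmn
  rw [Real.rpow_neg hn0.le, Real.rpow_neg hm0.le, ← div_eq_mul_inv, div_le_iff₀ (by positivity)]
    at this
  rwa [Real.div_rpow hn0.le hm0.le, div_eq_inv_mul, ← mul_assoc, mul_assoc C]

theorem potter_lower (h : RegularlyVarying ρ g) (hσ : -σ < ρ) :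
    ∃ C : ℝ, 0 < C ∧ ∀ m n : ℕ, 1 ≤ m → m ≤ n → g m ≤ C * g n * ((n : ℝ) / m) ^ σ := by
  obtain ⟨C, hC, hle⟩ := h.inv.potter_upper (show -ρ < σ by linarith)
  refine ⟨C, hC, fun m n hm hmn => ?_⟩
  have hgm := h.pos m hm
  have hgn := h.pos n (hm.trans hmn)
  have := hle m n hm hmn
  rw [inv_le_iff_one_le_mul₀ hgn] at this
  calc g m = g m * 1 := (mul_one _).symm
    _ ≤ g m * (C * (g m)⁻¹ * ((n : ℝ) / m) ^ σ * g n) := by gcongr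
    _ = C * g n * ((n : ℝ) / m) ^ σ := by field_simp

theorem exists_potter_lower_lt_one (h : RegularlyVarying ρ g) (hρ : -1 < ρ) :
    ∃ γ C : ℝ, 0 ≤ γ ∧ γ < 1 ∧ 0 < C ∧
      ∀ m n : ℕ, 1 ≤ m → m ≤ n → g m ≤ C * g n * ((n : ℝ) / m) ^ γ := by
  obtain ⟨γ, hγ, hγ1⟩ := exists_between (max_lt (neg_lt.1 hρ) one_pos : max (-ρ) 0 < 1)
  obtain ⟨hργ, hγ0⟩ := max_lt_iff.1 hγ
  obtain ⟨C, hC, hle⟩ := h.potter_lower (neg_lt.1 hργ)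
  exact ⟨γ, C, hγ0.le, hγ1, hC, hle⟩

theorem tendsto_zero (h : RegularlyVarying ρ g) (hρ : ρ < 0) : Tendsto g atTop (𝓝 0) := by
  obtain ⟨C, -, hC⟩ := h.potter_upper (show ρ < ρ / 2 by linarith)
  have hlim : Tendsto (fun n : ℕ => C * g 1 * ((n : ℝ) / (1 : ℕ)) ^ (ρ / 2)) atTop (𝓝 0) := by
    have := (tendsto_rpow_neg_atTop (show 0 < -(ρ / 2) by linarith)).comp
      tendsto_natCast_atTop_atTop
    simpa [Function.comp_def] using this.const_mul (C * g 1)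
  refine squeeze_zero' ?_ ?_ hlim
  · filter_upwards [eventually_ge_atTop 1] with n hn using (h.pos n hn).le
  · filter_upwards [eventually_ge_atTop 1] with n hn using hC 1 n le_rfl hn

/-- Monotonicity upgrades the convergence of `g ⌊n c⌋ / g n` for fixed `c` to continuous
convergence. -/
theorem of_antitone (hpos : ∀ n, 0 < g n) (hanti : Antitone g)
    (h : ∀ c : ℝ, 0 < c → Tendsto (fun n : ℕ => g ⌊(n : ℝ) * c⌋₊ / g n) atTop (𝓝 (c ^ ρ))) :
    RegularlyVarying ρ g := by
  refine ⟨fun n _ => hpos n, fun y hy => ?_⟩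
  have hcont : ContinuousAt (fun c : ℝ => c ^ ρ) y :=
    Real.continuousAt_rpow_const _ _ (Or.inl hy.ne')
  refine tendsto_order.2 ⟨fun a ha => ?_, fun a ha => ?_⟩
  · obtain ⟨c, hc, hyc⟩ := ((hcont.eventually_const_lt ha).filter_mono nhdsWithin_le_nhds |>.and
      (self_mem_nhdsWithin : ∀ᶠ c in 𝓝[>] y, y < c)).exists
    filter_upwards [tendsto_snd_ratioFilter ((h c (hy.trans hyc)).eventually_const_lt hc),
      tendsto_div_ratioFilter.eventually_lt_const hyc, eventually_one_le_ratioFilter hy]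
      with p hgt hpc hp1
    refine lt_of_lt_of_le hgt (div_le_div_of_nonneg_right (hanti (Nat.le_floor ?_)) (hpos _).le)
    rw [div_lt_iff₀ (by exact_mod_cast hp1.2)] at hpc
    linarith
  · obtain ⟨c, hc, hc0, hyc⟩ := ((hcont.eventually_lt_const ha).filter_mono
      nhdsWithin_le_nhds |>.and (Ioo_mem_nhdsLT hy)).exists
    filter_upwards [tendsto_snd_ratioFilter ((h c hc0).eventually_lt_const hc),
      tendsto_div_ratioFilter.eventually_const_lt hyc, eventually_one_le_ratioFilter hy]
      with p hlt hpc hp1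
    refine lt_of_le_of_lt
      (div_le_div_of_nonneg_right (hanti (Nat.floor_le_of_le ?_)) (hpos _).le) hlt
    rw [lt_div_iff₀ (by exact_mod_cast hp1.2)] at hpc
    linarith

end RegularlyVarying

section Riemann

variable {E : Type*} [NormedAddCommGroup E] (g : ℕ → E)

theorem intervalIntegrable_floor (k : ℕ) :
    IntervalIntegrable (fun y : ℝ => g ⌊y⌋₊) volume k (k + 1) := by
  rw [intervalIntegrable_iff_integrableOn_Ico_of_le (by simp)]
  exact (integrableOn_const (C := g k) (by simp)).congr_fun
    (fun y hy => by rw [Nat.floor_eq_on_Ico k y hy]) measurableSet_Ico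

variable [NormedSpace ℝ E]

theorem integral_floor [CompleteSpace E] (k : ℕ) :
    ∫ y in (k : ℝ)..(k + 1), g ⌊y⌋₊ = g k := by
  rw [intervalIntegral.integral_of_le (by simp), ← integral_Ico_eq_integral_Ioc,
    setIntegral_congr_fun (g := fun _ => g k) measurableSet_Ico
      fun y hy => by rw [Nat.floor_eq_on_Ico k y hy]]
  simp

theorem inv_smul_sum_eq_integral [CompleteSpace E] {n : ℕ} (hn : 0 < n) (M : ℕ) :
    (n : ℝ)⁻¹ • ∑ k ∈ Finset.range (n * M), g k = ∫ x in (0 : ℝ)..M, g ⌊(n : ℝ) * x⌋₊ := by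
  have hsum := intervalIntegral.sum_integral_adjacent_intervals (μ := volume) (n := n * M)
    (f := fun y : ℝ => g ⌊y⌋₊) (a := fun k : ℕ => (k : ℝ))
    fun k _ => by simpa only [Nat.cast_succ] using intervalIntegrable_floor g k
  simp only [Nat.cast_succ, integral_floor] at hsum
  rw [intervalIntegral.integral_comp_mul_left (fun y => g ⌊y⌋₊) (by positivity), mul_zero, hsum]
  simp only [Nat.cast_zero, Nat.cast_mul]

variable {g} in
/-- The term `k = 0` is left out of the sum because the dominating function `b` need not control
it: `b` is typically a power with a singularity at `0`. -/
theorem tendsto_riemann_sum [CompleteSpace E] {H : ℕ → ℕ → E} {h : ℝ → E} {b : ℝ → ℝ} {M : ℕ}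
    (hb : IntegrableOn b (Set.Ioo 0 M))
    (hbound : ∀ n : ℕ, ∀ x ∈ Set.Ioo (0 : ℝ) M, 1 ≤ n → 1 ≤ ⌊(n : ℝ) * x⌋₊ →
      ‖H n ⌊(n : ℝ) * x⌋₊‖ ≤ b x)
    (hlim : ∀ x ∈ Set.Ioo (0 : ℝ) M, Tendsto (fun n : ℕ => H n ⌊(n : ℝ) * x⌋₊) atTop (𝓝 (h x))) :
    Tendsto (fun n : ℕ => (n : ℝ)⁻¹ • ∑ k ∈ Finset.Ico 1 (n * M), H n k) atTop
      (𝓝 (∫ x in (0 : ℝ)..M, h x)) := by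
  have hM : (0 : ℝ) ≤ M := Nat.cast_nonneg _
  let K : ℕ → ℕ → E := fun n => Function.update (H n) 0 0
  have hK : ∀ n k, 1 ≤ k → K n k = H n k := fun n k hk =>
    Function.update_of_ne (Nat.one_le_iff_ne_zero.1 hk) _ _
  have hint : Tendsto (fun n : ℕ => ∫ x in Set.Ioo (0 : ℝ) M, K n ⌊(n : ℝ) * x⌋₊) atTop
      (𝓝 (∫ x in Set.Ioo (0 : ℝ) M, h x)) := by
    refine tendsto_integral_filter_of_dominated_convergence (fun x => ‖b x‖) ?_ ?_ hb.norm ?_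
    · refine Eventually.of_forall fun n => StronglyMeasurable.aestronglyMeasurable ?_
      exact (StronglyMeasurable.of_discrete (f := K n)).comp_measurable
        (Nat.measurable_floor.comp (measurable_const_mul _))
    · filter_upwards [eventually_ge_atTop 1] with n hn
      refine (ae_restrict_iff' measurableSet_Ioo).2 (Eventually.of_forall fun x hx => ?_)
      rcases Nat.eq_zero_or_pos ⌊(n : ℝ) * x⌋₊ with hk | hk
      · simp only [K, hk, Function.update_self, norm_zero, norm_nonneg]
      · rw [hK n _ hk]
        exact (hbound n x hx hn hk).trans (le_abs_self _)
    · refine (ae_restrict_iff' measurableSet_Ioo).2 (Eventually.of_forall fun x hx => ?_)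
      refine (hlim x hx).congr' ?_
      filter_upwards [(tendsto_floor_mul_atTop hx.1).eventually_ge_atTop 1] with n hn
      rw [hK n _ hn]
  rw [intervalIntegral.integral_of_le hM, integral_Ioc_eq_integral_Ioo]
  refine hint.congr' ?_
  filter_upwards [eventually_ge_atTop 1] with n hn
  rw [← integral_Ioc_eq_integral_Ioo, ← intervalIntegral.integral_of_le hM,
    ← inv_smul_sum_eq_integral (K n) hn, Finset.range_eq_Ico]
  congr 1
  rcases Nat.eq_zero_or_pos (n * M) with h0 | h0
  · simp only [h0, Finset.Ico_self, Finset.Ico_eq_empty_of_le zero_le_one, Finset.sum_empty]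
  · rw [Finset.sum_eq_sum_Ico_succ_bot h0, show K n 0 = 0 from Function.update_self _ _ _, zero_add]
    exact Finset.sum_congr rfl fun k hk => hK n k (Finset.mem_Ico.1 hk).1

end Riemann

section Beta

variable {ρ σ : ℝ}

theorem integral_rpow_mul_one_sub_rpow (hρ : -1 < ρ) (hσ : -1 < σ) :
    ∫ x in (0 : ℝ)..1, x ^ ρ * (1 - x) ^ σ = beta (ρ + 1) (σ + 1) := by
  have hcast : Complex.betaIntegral (ρ + 1 : ℝ) (σ + 1 : ℝ)
      = ∫ x in (0 : ℝ)..1, ((x ^ ρ * (1 - x) ^ σ : ℝ) : ℂ) := by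
    refine intervalIntegral.integral_congr fun x hx => ?_
    rw [Set.uIcc_of_le zero_le_one] at hx
    rw [Complex.ofReal_mul, Complex.ofReal_cpow hx.1, Complex.ofReal_cpow (by linarith [hx.2])]
    push_cast
    simp only [add_sub_cancel_right]
  rw [beta_eq_betaIntegralReal _ _ (by linarith) (by linarith), hcast,
    intervalIntegral.integral_ofReal, Complex.ofReal_re]

theorem integrableOn_rpow_mul_one_sub_rpow (hρ : -1 < ρ) (hσ : -1 < σ) :
    IntegrableOn (fun x : ℝ => x ^ ρ * (1 - x) ^ σ) (Set.Ioo 0 1) := by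
  have hbeta := Complex.betaIntegral_convergent (u := (ρ + 1 : ℝ)) (v := (σ + 1 : ℝ))
    (by simpa [neg_lt_iff_pos_add] using hρ) (by simpa [neg_lt_iff_pos_add] using hσ)
  rw [intervalIntegrable_iff_integrableOn_Ioo_of_le zero_le_one] at hbeta
  refine IntegrableOn.congr_fun hbeta.norm (fun x hx => ?_) measurableSet_Ioo
  have hx' : 0 < 1 - x := sub_pos.2 hx.2
  rw [norm_mul, Complex.norm_cpow_eq_rpow_re_of_pos hx.1,
    show (1 : ℂ) - x = (1 - x : ℝ) by push_cast; rfl, Complex.norm_cpow_eq_rpow_re_of_pos hx']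
  simp

theorem beta_one_right (hρ : -1 < ρ) : beta (ρ + 1) 1 = (ρ + 1)⁻¹ := by
  have hpos : 0 < ρ + 1 := by linarith
  have hΓ := (Real.Gamma_pos_of_pos hpos).ne'
  rw [beta, Real.Gamma_one, Real.Gamma_add_one hpos.ne']
  field_simp

theorem beta_self_one_sub (s : ℝ) : beta s (1 - s) = Real.Gamma s * Real.Gamma (1 - s) := by
  rw [beta, add_sub_cancel, Real.Gamma_one, div_one]

end Beta

theorem tendsto_sub_floor_ratioFilter {x : ℝ} (hx0 : 0 ≤ x) (hx1 : x ≤ 1) :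
    Tendsto (fun n : ℕ => (n - ⌊(n : ℝ) * x⌋₊, n)) atTop (ratioFilter (1 - x)) := by
  refine tendsto_ratioFilter tendsto_id
    ((tendsto_const_nhds.sub (tendsto_floor_mul_div hx0)).congr' ?_)
  filter_upwards [eventually_ge_atTop 1] with n hn
  have hn0 : (n : ℝ) ≠ 0 := by positivity
  have hle : ⌊(n : ℝ) * x⌋₊ ≤ n :=
    Nat.floor_le_of_le (mul_le_of_le_one_right (Nat.cast_nonneg _) hx1)
  rw [Nat.cast_sub hle, sub_div, div_self hn0]

namespace RegularlyVarying

variable {ρ σ : ℝ} {g : ℕ → ℝ}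

theorem exists_div_le (h : RegularlyVarying ρ g) (hρ : -1 < ρ) :
    ∃ γ C : ℝ, 0 ≤ γ ∧ γ < 1 ∧ 0 < C ∧ ∀ k n : ℕ, ∀ y : ℝ, 1 ≤ k → k ≤ n → 0 < y →
      n * y ≤ 2 * k → g k / g n ≤ C * y ^ (-γ) := by
  obtain ⟨γ, C, hγ0, hγ1, hC, hle⟩ := h.exists_potter_lower_lt_one hρ
  refine ⟨γ, C * 2 ^ γ, hγ0, hγ1, by positivity, fun k n y hk hkn hy hky => ?_⟩
  have hgn := h.pos n (hk.trans hkn)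
  have hk0 : (0 : ℝ) < k := by exact_mod_cast hk
  have hdiv : (n : ℝ) / k ≤ 2 / y := by rwa [div_le_div_iff₀ hk0 hy]
  rw [div_le_iff₀ hgn]
  calc g k ≤ C * g n * ((n : ℝ) / k) ^ γ := hle k n hk hkn
    _ ≤ C * g n * (2 / y) ^ γ := by gcongr
    _ = C * 2 ^ γ * y ^ (-γ) * g n := by
        rw [Real.div_rpow two_pos.le hy.le, Real.rpow_neg hy.le]
        ring

theorem exists_div_mul_div_le {a b : ℕ → ℝ} (ha : RegularlyVarying ρ a)
    (hb : RegularlyVarying σ b) (hρ : -1 < ρ) (hσ : -1 < σ) :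
    ∃ γ γ' C : ℝ, γ < 1 ∧ γ' < 1 ∧ ∀ n k : ℕ, ∀ x ∈ Set.Ioo (0 : ℝ) 1, 1 ≤ k →
      ⌊(n : ℝ) * x⌋₊ = k → |a k / a n * (b (n - k) / b n)| ≤ C * (x ^ (-γ) * (1 - x) ^ (-γ')) := by
  obtain ⟨γ, C, -, hγ1, hC, hab⟩ := ha.exists_div_le hρ
  obtain ⟨γ', C', -, hγ1', _, hbb⟩ := hb.exists_div_le hσ
  refine ⟨γ, γ', C * C', hγ1, hγ1', ?_⟩
  rintro n k x ⟨hx0, hx1⟩ hk rfl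
  set k := ⌊(n : ℝ) * x⌋₊
  have hkx : (k : ℝ) ≤ n * x := Nat.floor_le (by positivity)
  have hxk : n * x < k + 1 := Nat.lt_floor_add_one _
  have hk1 : (1 : ℝ) ≤ k := by exact_mod_cast hk
  have hkn : k < n := by exact_mod_cast (by nlinarith : (k : ℝ) < n)
  have hA : a k / a n ≤ C * x ^ (-γ) := hab k n x hk hkn.le hx0 (by linarith)
  have hB : b (n - k) / b n ≤ C' * (1 - x) ^ (-γ') := by
    refine hbb (n - k) n (1 - x) (by omega) (Nat.sub_le _ _) (sub_pos.2 hx1) ?_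
    rw [Nat.cast_sub hkn.le]
    nlinarith
  have hA0 := div_pos (ha.pos k hk) (ha.pos n (by omega))
  have hB0 := div_pos (hb.pos (n - k) (by omega)) (hb.pos n (by omega))
  rw [abs_of_pos (mul_pos hA0 hB0)]
  calc a k / a n * (b (n - k) / b n) ≤ C * x ^ (-γ) * (C' * (1 - x) ^ (-γ')) := by gcongr
    _ = C * C' * (x ^ (-γ) * (1 - x) ^ (-γ')) := by ring

theorem tendsto_conv {a b e : ℕ → ℝ} {c : ℝ} (ha : RegularlyVarying ρ a)
    (hb : RegularlyVarying σ b) (hρ : -1 < ρ) (hσ : -1 < σ) (he : Tendsto e atTop (𝓝 c)) :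
    Tendsto (fun n : ℕ => (∑ k ∈ Finset.Ico 1 n, e k * a k * b (n - k)) / (n * a n * b n)) atTop
      (𝓝 (c * beta (ρ + 1) (σ + 1))) := by
  obtain ⟨γ, γ', C, hγ, hγ', hab⟩ := ha.exists_div_mul_div_le hb hρ hσ
  obtain ⟨D, hD⟩ := he.norm.bddAbove_range
  have hD' : ∀ k, ‖e k‖ ≤ D := fun k => hD ⟨k, rfl⟩
  have hD0 : 0 ≤ D := (norm_nonneg _).trans (hD' 0)
  have hsum := tendsto_riemann_sum (M := 1)
    (H := fun n k => e k * (a k / a n * (b (n - k) / b n)))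
    (h := fun x => c * (x ^ ρ * (1 - x) ^ σ))
    (b := fun x => D * (C * (x ^ (-γ) * (1 - x) ^ (-γ')))) ?_ ?_ ?_
  · rw [Nat.cast_one, intervalIntegral.integral_const_mul,
      integral_rpow_mul_one_sub_rpow hρ hσ] at hsum
    simp only [mul_one] at hsum
    refine hsum.congr fun n => ?_
    rw [smul_eq_mul, Finset.mul_sum, Finset.sum_div]
    exact Finset.sum_congr rfl fun k _ => by ring
  · rw [Nat.cast_one]
    exact ((integrableOn_rpow_mul_one_sub_rpow (by linarith) (by linarith)).const_mul _).const_mul _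
  · intro n x hx _ hk
    rw [Nat.cast_one] at hx
    rw [norm_mul]
    exact mul_le_mul (hD' _) (hab n _ x hx hk rfl) (norm_nonneg _) hD0
  · rintro x ⟨hx0, hx1⟩
    rw [Nat.cast_one] at hx1
    exact (he.comp (tendsto_floor_mul_atTop hx0)).mul
      (((ha.tendsto_ratio x hx0).comp (tendsto_floor_mul_ratioFilter hx0.le)).mul
        ((hb.tendsto_ratio (1 - x) (sub_pos.2 hx1)).comp
          (tendsto_sub_floor_ratioFilter hx0.le hx1.le)))

theorem tendsto_sum_renewal_mul {c : ℝ} {u : ℕ → ℝ} (hg : RegularlyVarying ρ g) (hρ0 : ρ < 0)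
    (hρ1 : -1 < ρ) (hu : Tendsto (fun n : ℕ => n * g n * u n) atTop (𝓝 c)) :
    Tendsto (fun n : ℕ => ∑ k ∈ Finset.range (n + 1), u k * g (n - k)) atTop
      (𝓝 (c * (Real.Gamma (-ρ) * Real.Gamma (1 - -ρ)))) := by
  have ha := hg.inv_natCast_mul
  have hcancel : ∀ k : ℕ, 1 ≤ k → k * g k * u k * (k * g k)⁻¹ = u k := fun k hk => by
    have := hg.pos k hk
    field_simp
  have hu0 : Tendsto u atTop (𝓝 0) := by
    have hlim := hu.mul (ha.tendsto_zero (by linarith))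
    rw [mul_zero] at hlim
    refine hlim.congr' ?_
    filter_upwards [eventually_ge_atTop 1] with n hn using hcancel n hn
  have hconv := ha.tendsto_conv hg (by linarith) hρ1 hu
  have hlim := (((hg.tendsto_zero hρ0).const_mul (u 0)).add hconv).add (hu0.mul_const (g 0))
  rw [mul_zero, zero_mul, zero_add, add_zero, show -(1 + ρ) + 1 = -ρ by ring,
    show ρ + 1 = 1 - -ρ by ring, beta_self_one_sub] at hlim
  refine hlim.congr' ?_
  filter_upwards [eventually_ge_atTop 1] with n hn
  have hn0 : (n : ℝ) ≠ 0 := by positivity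
  have hgn := hg.pos n hn
  have hdenom : (n : ℝ) * (n * g n)⁻¹ * g n = 1 := by field_simp
  rw [hdenom, div_one, Finset.sum_range_succ, Finset.range_eq_Ico,
    Finset.sum_eq_sum_Ico_succ_bot hn, Nat.sub_self, Nat.sub_zero]
  congr 2
  exact Finset.sum_congr rfl fun k hk => by rw [hcancel k (Finset.mem_Ico.1 hk).1]

theorem tendsto_sum (hg : RegularlyVarying ρ g) (hρ : -1 < ρ) :
    Tendsto (fun n : ℕ => (∑ k ∈ Finset.range (n + 1), g k) / (n * g n)) atTop
      (𝓝 (ρ + 1)⁻¹) := by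
  have hconv := hg.tendsto_conv one hρ (by norm_num) (tendsto_const_nhds (x := (1 : ℝ)))
  have hfirst := (hg.inv_natCast_mul.tendsto_zero (by linarith)).const_mul (g 0)
  have hlast : Tendsto (fun n : ℕ => (n : ℝ)⁻¹) atTop (𝓝 0) := tendsto_inv_atTop_nhds_zero_nat
  have hlim := (hfirst.add hconv).add hlast
  rw [mul_zero, zero_add (1 : ℝ), beta_one_right hρ, one_mul, zero_add, add_zero] at hlim
  refine hlim.congr' ?_
  filter_upwards [eventually_ge_atTop 1] with n hn
  have hgn := (hg.pos n hn).ne'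
  have hn0 : (n : ℝ) ≠ 0 := by positivity
  rw [Finset.sum_range_succ, Finset.range_eq_Ico, Finset.sum_eq_sum_Ico_succ_bot hn]
  simp only [one_mul, mul_one, zero_add]
  field_simp

end RegularlyVarying

theorem coeff_mk_mul_mk {R : Type*} [Semiring R] (a b : ℕ → R) (n : ℕ) :
    PowerSeries.coeff n (PowerSeries.mk a * PowerSeries.mk b)
      = ∑ k ∈ Finset.range (n + 1), a k * b (n - k) := by
  simp only [PowerSeries.coeff_mul, PowerSeries.coeff_mk]
  exact Finset.Nat.sum_antidiagonal_eq_sum_range_succ (fun i j => a i * b j) n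

section Averages

variable {F w : ℕ → ℝ} {M : ℝ}

theorem exists_abs_sum_mul_le (hF0 : ∀ n, 0 ≤ F n) (hFM : ∀ n, F n ≤ M)
    (hw : Tendsto w atTop (𝓝 0)) {ε : ℝ} (hε : 0 < ε) :
    ∃ K, ∀ n : ℕ, |∑ k ∈ Finset.range (n + 1), F k * w (n - k)|
      ≤ ε * (∑ k ∈ Finset.range (n + 1), F k) + K := by
  obtain ⟨N, hN⟩ := Metric.tendsto_atTop.1 hw ε hε
  set r : ℕ → ℝ := fun j => if j < N then |w j| else 0
  have hr0 : ∀ j, 0 ≤ r j := fun j => by positivity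
  have hwr : ∀ j, |w j| ≤ ε + r j := by
    intro j
    by_cases hj : j < N
    · simp only [r, if_pos hj]
      linarith
    · simp only [r, if_neg hj, add_zero]
      simpa using (hN j (not_lt.1 hj)).le
  have hM0 : 0 ≤ M := (hF0 0).trans (hFM 0)
  refine ⟨M * ∑ j ∈ Finset.range N, |w j|, fun n => ?_⟩
  have hrsum : ∑ k ∈ Finset.range (n + 1), r (n - k) ≤ ∑ j ∈ Finset.range N, |w j| := by
    have hreflect := Finset.sum_range_reflect r (n + 1)
    rw [Nat.add_sub_cancel] at hreflect
    rw [hreflect, ← Finset.sum_filter]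
    exact Finset.sum_le_sum_of_subset_of_nonneg
      (fun j hj => Finset.mem_range.2 (Finset.mem_filter.1 hj).2) fun _ _ _ => abs_nonneg _
  calc |∑ k ∈ Finset.range (n + 1), F k * w (n - k)|
      ≤ ∑ k ∈ Finset.range (n + 1), |F k * w (n - k)| := Finset.abs_sum_le_sum_abs _ _
    _ ≤ ∑ k ∈ Finset.range (n + 1), (ε * F k + M * r (n - k)) := by
        refine Finset.sum_le_sum fun k _ => ?_
        rw [abs_mul, abs_of_nonneg (hF0 k)]
        nlinarith [mul_le_mul_of_nonneg_left (hwr (n - k)) (hF0 k),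
          mul_le_mul_of_nonneg_right (hFM k) (hr0 (n - k))]
    _ = ε * ∑ k ∈ Finset.range (n + 1), F k + M * ∑ k ∈ Finset.range (n + 1), r (n - k) := by
        rw [Finset.sum_add_distrib, Finset.mul_sum, Finset.mul_sum]
    _ ≤ _ := by gcongr

theorem tendsto_sum_mul_div_sum {B : ℝ} (hF0 : ∀ n, 0 ≤ F n) (hFM : ∀ n, F n ≤ M)
    (hw : Tendsto w atTop (𝓝 B))
    (hsum : Tendsto (fun n => ∑ k ∈ Finset.range (n + 1), F k) atTop atTop) :
    Tendsto (fun n => (∑ k ∈ Finset.range (n + 1), F k * w (n - k)) /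
      ∑ k ∈ Finset.range (n + 1), F k) atTop (𝓝 B) := by
  have hw0 : Tendsto (fun n => w n - B) atTop (𝓝 0) := by simpa using hw.sub_const B
  refine Metric.tendsto_nhds.2 fun ε hε => ?_
  obtain ⟨K, hK⟩ := exists_abs_sum_mul_le hF0 hFM hw0 (half_pos hε)
  filter_upwards [hsum.eventually_gt_atTop 0, hsum.eventually_gt_atTop (2 * K / ε)] with n hn hKn
  rw [div_lt_iff₀ hε] at hKn
  have hbound := hK n
  simp only [mul_sub, Finset.sum_sub_distrib, ← Finset.sum_mul] at hbound
  rw [Real.dist_eq, div_sub' hn.ne', abs_div, abs_of_pos hn, div_lt_iff₀ hn]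
  linarith

end Averages

theorem sum_mul_sum_mul_eq {u F : ℕ → ℝ}
    (hconv : ∀ n, ∑ k ∈ Finset.range (n + 1), u k * F (n - k) = 1) (g : ℕ → ℝ) (n : ℕ) :
    ∑ k ∈ Finset.range (n + 1), F k * ∑ i ∈ Finset.range (n - k + 1), u i * g (n - k - i)
      = ∑ k ∈ Finset.range (n + 1), g k := by
  have huF : PowerSeries.mk u * PowerSeries.mk F = PowerSeries.mk fun _ => 1 := by
    ext n
    rw [coeff_mk_mul_mk, hconv, PowerSeries.coeff_mk]
  let w : ℕ → ℝ := fun n => ∑ i ∈ Finset.range (n + 1), u i * g (n - i)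
  have hug : PowerSeries.mk u * PowerSeries.mk g = PowerSeries.mk w := by
    ext n
    rw [coeff_mk_mul_mk, PowerSeries.coeff_mk]
  change ∑ k ∈ Finset.range (n + 1), F k * w (n - k) = _
  rw [← coeff_mk_mul_mk F, ← hug, ← mul_assoc, mul_comm (PowerSeries.mk F), huF, mul_comm,
    coeff_mk_mul_mk]
  simp only [mul_one]

section AntitoneSum

variable {F : ℕ → ℝ} {n k : ℕ}

theorem sum_sub_sum_le_of_antitone (hF : Antitone F) (hnk : n ≤ k) :
    ∑ i ∈ Finset.range (k + 1), F i - ∑ i ∈ Finset.range (n + 1), F i ≤ (k - n) * F n := by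
  rw [← Finset.sum_Ico_eq_sub _ (by omega)]
  refine (Finset.sum_le_card_nsmul _ _ (F n)
    fun i hi => hF (by have := Finset.mem_Ico.1 hi; omega)).trans_eq ?_
  rw [Nat.card_Ico, Nat.add_sub_add_right, nsmul_eq_mul, Nat.cast_sub hnk]

theorem le_sum_sub_sum_of_antitone (hF : Antitone F) (hkn : k ≤ n) :
    (n - k) * F n ≤ ∑ i ∈ Finset.range (n + 1), F i - ∑ i ∈ Finset.range (k + 1), F i := by
  rw [← Finset.sum_Ico_eq_sub _ (by omega)]
  refine Eq.trans_le ?_ (Finset.card_nsmul_le_sum _ _ (F n)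
    fun i hi => hF (by have := Finset.mem_Ico.1 hi; omega))
  rw [Nat.card_Ico, Nat.add_sub_add_right, nsmul_eq_mul, Nat.cast_sub hkn]

end AntitoneSum

theorem tendsto_slope_mul_rpow (s A : ℝ) :
    Tendsto (fun x : ℝ => (A * x ^ s - A) / (x - 1)) (𝓝[≠] 1) (𝓝 (A * s)) := by
  have hderiv := ((Real.hasDerivAt_rpow_const (x := 1) (p := s) (Or.inl one_ne_zero)).const_mul
    A).tendsto_slope
  rw [Real.one_rpow, mul_one] at hderiv
  refine hderiv.congr fun x => ?_
  rw [slope_def_field, Real.one_rpow, mul_one]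

namespace RegularlyVarying

variable {ρ : ℝ} {g : ℕ → ℝ}

theorem natCast_mul (hg : RegularlyVarying ρ g) : RegularlyVarying (1 + ρ) (fun n => n * g n) :=
  ((rpow 1).mul hg).congr rfl fun n _ => by rw [Real.rpow_one]

theorem tendsto_natCast_mul_atTop (hg : RegularlyVarying ρ g) (hρ : -1 < ρ) :
    Tendsto (fun n : ℕ => n * g n) atTop atTop := by
  have hinv : Tendsto (fun n : ℕ => (n * g n)⁻¹) atTop (𝓝[>] 0) :=
    tendsto_nhdsWithin_iff.2 ⟨hg.inv_natCast_mul.tendsto_zero (by linarith), by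
      filter_upwards [eventually_ge_atTop 1] with n hn using hg.inv_natCast_mul.pos n hn⟩
  exact hinv.inv_tendsto_nhdsGT_zero.congr fun n => inv_inv _

theorem tendsto_increment {A x : ℝ} {Φ : ℕ → ℝ} (hg : RegularlyVarying ρ g)
    (h : Tendsto (fun n : ℕ => Φ n / (n * g n)) atTop (𝓝 A)) (hx : 0 < x) (hx1 : x ≠ 1) :
    Tendsto (fun n : ℕ => (Φ ⌊(n : ℝ) * x⌋₊ - Φ n) / (⌊(n : ℝ) * x⌋₊ - n) / g n) atTop
      (𝓝 ((A * x ^ (1 + ρ) - A) / (x - 1))) := by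
  have hk := tendsto_floor_mul_atTop hx
  have hΦ := (h.comp hk).mul
    ((hg.natCast_mul.tendsto_ratio x hx).comp (tendsto_floor_mul_ratioFilter hx.le))
  refine ((hΦ.sub h).div ((tendsto_floor_mul_div hx.le).sub_const 1) (sub_ne_zero.2 hx1)).congr' ?_
  filter_upwards [eventually_ge_atTop 1, hk.eventually_ge_atTop 1] with n hn hkn
  have hn0 : (n : ℝ) ≠ 0 := by positivity
  have hk0 : (⌊(n : ℝ) * x⌋₊ : ℝ) ≠ 0 := by positivity
  have hgn := (hg.pos n hn).ne'
  have hgk := (hg.pos _ hkn).ne'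
  simp only [Function.comp, Pi.div_apply]
  rw [div_sub_one hn0]
  field_simp

theorem tendsto_of_tendsto_sum {A : ℝ} {F : ℕ → ℝ} (hg : RegularlyVarying ρ g) (hF : Antitone F)
    (h : Tendsto (fun n : ℕ => (∑ k ∈ Finset.range (n + 1), F k) / (n * g n)) atTop (𝓝 A)) :
    Tendsto (fun n => F n / g n) atTop (𝓝 (A * (1 + ρ))) := by
  have hslope := tendsto_slope_mul_rpow (1 + ρ) A
  refine tendsto_order.2 ⟨fun a ha => ?_, fun a ha => ?_⟩
  · obtain ⟨x, hax, hx1⟩ :=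
      ((hslope.mono_left (nhdsGT_le_nhdsNE _)).eventually_const_lt ha |>.and
        self_mem_nhdsWithin).exists
    have hx0 : 0 < x := one_pos.trans hx1
    filter_upwards [(hg.tendsto_increment h hx0 hx1.ne').eventually_const_lt hax,
      eventually_ge_atTop 1, (tendsto_floor_mul_div hx0.le).eventually_const_lt hx1]
      with n hlt hn hk
    rw [one_lt_div (by exact_mod_cast hn)] at hk
    refine hlt.trans_le (div_le_div_of_nonneg_right ?_ (hg.pos n hn).le)
    rw [div_le_iff₀' (sub_pos.2 hk)]
    exact sum_sub_sum_le_of_antitone hF (by exact_mod_cast hk.le)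
  · obtain ⟨x, hax, hx0, hx1⟩ :=
      ((hslope.mono_left (nhdsLT_le_nhdsNE _)).eventually_lt_const ha |>.and
        (Ioo_mem_nhdsLT one_pos)).exists
    filter_upwards [(hg.tendsto_increment h hx0 hx1.ne).eventually_lt_const hax,
      eventually_ge_atTop 1, (tendsto_floor_mul_div hx0.le).eventually_lt_const hx1]
      with n hlt hn hk
    rw [div_lt_one (by exact_mod_cast hn)] at hk
    refine (div_le_div_of_nonneg_right ?_ (hg.pos n hn).le).trans_lt hlt
    rw [← neg_sub (n : ℝ), ← neg_sub (∑ i ∈ Finset.range (n + 1), F i), neg_div_neg_eq,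
      le_div_iff₀' (sub_pos.2 hk)]
    exact le_sum_sub_sum_of_antitone hF (by exact_mod_cast hk.le)

/-- A Tauberian converse to the strong renewal theorem. Convolving the tail with
`w = u * g → Γ(-ρ) Γ(1 + ρ)` gives the partial sums of `g`, whose growth Karamata's theorem
determines; so the partial sums of `F` are known and monotone density recovers `F` itself. -/
theorem tendsto_tail {u F : ℕ → ℝ} (hg : RegularlyVarying ρ g) (hρ0 : ρ < 0) (hρ1 : -1 < ρ)
    (hu : Tendsto (fun n : ℕ => n * g n * u n) atTop (𝓝 1)) (hF : Antitone F)
    (hF0 : ∀ n, 0 ≤ F n) (hconv : ∀ n, ∑ k ∈ Finset.range (n + 1), u k * F (n - k) = 1) :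
    Tendsto (fun n => F n / g n) atTop (𝓝 (Real.Gamma (-ρ) * Real.Gamma (1 - -ρ))⁻¹) := by
  set B := Real.Gamma (-ρ) * Real.Gamma (1 - -ρ)
  have hB0 : 0 < B :=
    mul_pos (Real.Gamma_pos_of_pos (by linarith)) (Real.Gamma_pos_of_pos (by linarith))
  set w : ℕ → ℝ := fun n => ∑ k ∈ Finset.range (n + 1), u k * g (n - k)
  have hw : Tendsto w atTop (𝓝 B) := by
    simpa only [one_mul] using hg.tendsto_sum_renewal_mul hρ0 hρ1 hu
  set G : ℕ → ℝ := fun n => ∑ k ∈ Finset.range (n + 1), g k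
  set Φ : ℕ → ℝ := fun n => ∑ k ∈ Finset.range (n + 1), F k
  have hGeq : ∀ n, ∑ k ∈ Finset.range (n + 1), F k * w (n - k) = G n := sum_mul_sum_mul_eq hconv g
  have hG : Tendsto (fun n : ℕ => G n / (n * g n)) atTop (𝓝 (ρ + 1)⁻¹) := hg.tendsto_sum hρ1
  have hngtop := hg.tendsto_natCast_mul_atTop hρ1
  have hGtop : Tendsto G atTop atTop := by
    refine (hG.pos_mul_atTop (inv_pos.2 (by linarith)) hngtop).congr' ?_
    filter_upwards [hngtop.eventually_ne_atTop 0] with n hn using div_mul_cancel₀ _ hn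
  have hΦtop : Tendsto Φ atTop atTop := by
    obtain ⟨D, hD⟩ := hw.bddAbove_range
    have hD1 : ∀ n, w n ≤ max D 1 := fun n => (hD ⟨n, rfl⟩).trans (le_max_left _ _)
    refine tendsto_atTop_mono (fun n => ?_) (hGtop.atTop_div_const (r := max D 1) (by positivity))
    rw [div_le_iff₀ (by positivity), ← hGeq, Finset.sum_mul]
    exact Finset.sum_le_sum fun k _ => mul_le_mul_of_nonneg_left (hD1 _) (hF0 k)
  have hratio : Tendsto (fun n => G n / Φ n) atTop (𝓝 B) := by
    simpa only [hGeq] using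
      tendsto_sum_mul_div_sum hF0 (fun n => hF (Nat.zero_le n)) hw hΦtop
  have hΦ : Tendsto (fun n : ℕ => Φ n / (n * g n)) atTop (𝓝 ((ρ + 1)⁻¹ / B)) := by
    refine (hG.div hratio hB0.ne').congr' ?_
    filter_upwards [hGtop.eventually_ne_atTop 0] with n hn using div_div_div_cancel_left' _ _ hn
  have hρ : ρ + 1 ≠ 0 := by linarith
  convert hg.tendsto_of_tendsto_sum hF hΦ using 2
  field_simp
  ring

end RegularlyVarying

section PowerSeries
open PowerSeries

/-- A power series all of whose coefficients are nonnegative; the coefficientwise order `A ≤ B` is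
expressed as `CoeffNonneg (B - A)`. -/
def CoeffNonneg {R : Type*} [Semiring R] [LE R] (A : PowerSeries R) : Prop :=
  ∀ n, 0 ≤ coeff n A

namespace CoeffNonneg

theorem const {R : Type*} [Semiring R] [Preorder R] {c : R} (hc : 0 ≤ c) :
    CoeffNonneg (C c) := fun n => by
  rw [coeff_C]
  split_ifs
  exacts [hc, le_rfl]

section OrderedSemiring
variable {R : Type*} [Semiring R] [PartialOrder R] [IsOrderedRing R] {A B : PowerSeries R}

theorem add (hA : CoeffNonneg A) (hB : CoeffNonneg B) : CoeffNonneg (A + B) := fun n => by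
  rw [map_add]
  exact add_nonneg (hA n) (hB n)

theorem mul (hA : CoeffNonneg A) (hB : CoeffNonneg B) : CoeffNonneg (A * B) := fun n => by
  rw [coeff_mul]
  exact Finset.sum_nonneg fun _ _ => mul_nonneg (hA _) (hB _)

theorem one : CoeffNonneg (1 : PowerSeries R) := by
  rw [← map_one C]
  exact const zero_le_one

theorem pow (hA : CoeffNonneg A) : ∀ k : ℕ, CoeffNonneg (A ^ k)
  | 0 => by rw [pow_zero]; exact one
  | k + 1 => by rw [pow_succ]; exact (hA.pow k).mul hA

end OrderedSemiring

variable {R : Type*} [CommRing R] [LinearOrder R] [IsStrictOrderedRing R] {A B P : PowerSeries R}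

theorem of_mul_const_sub {c : R} (hc : 0 < c) (hP : CoeffNonneg P) (hP0 : coeff 0 P = 0)
    (hB : CoeffNonneg B) (h : A * (C c - P) = B) : CoeffNonneg A := by
  intro n
  induction n using Nat.strong_induction_on with
  | _ n ih =>
    have hrec : c * coeff n A =
        coeff n B +
          ∑ x ∈ Finset.HasAntidiagonal.antidiagonal n, coeff x.1 P * coeff x.2 A := by
      rw [← coeff_C_mul, ← coeff_mul, ← map_add, ← h]
      congr 1
      ring
    have hsum : 0 ≤ ∑ x ∈ Finset.HasAntidiagonal.antidiagonal n, coeff x.1 P * coeff x.2 A := by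
      refine Finset.sum_nonneg fun x hx => ?_
      rw [Finset.HasAntidiagonal.mem_antidiagonal] at hx
      rcases Nat.eq_zero_or_pos x.1 with h0 | h0
      · rw [h0, hP0, zero_mul]
      · exact mul_nonneg (hP _) (ih _ (by lia))
    exact nonneg_of_mul_nonneg_right (hrec ▸ add_nonneg (hB n) hsum) hc

end CoeffNonneg

theorem coeff_X_mul_derivative {R : Type*} [CommSemiring R] (A : PowerSeries R) (n : ℕ) :
    coeff n (X * derivative R A) = n * coeff n A := by
  cases n with
  | zero => simp
  | succ n => rw [coeff_succ_X_mul, coeff_derivative]; push_cast; ring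

/-- `P`, `F` and `U` are the generating functions of the law of the gaps of a renewal process, of
its tail, and of its renewal masses. -/
structure RenewalSeries (P F U : PowerSeries ℝ) : Prop where
  coeffNonneg_law : CoeffNonneg P
  coeffNonneg_tail : CoeffNonneg F
  coeff_zero_law : coeff 0 P = 0
  one_sub_law : 1 - P = (1 - X) * F
  mass_mul_one_sub : U * (1 - P) = 1

/-- The generating function `∑ k, P ^ k / (1 + ε) ^ (k + 1)` of the renewal masses discounted
geometrically in the number of renewals. Unlike the renewal masses themselves it is absolutely
summable when `ε > 0`. -/
noncomputable def discounted (P : PowerSeries ℝ) (ε : ℝ) : PowerSeries ℝ :=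
  (C (1 + ε) - P)⁻¹

theorem discounted_mul {P : PowerSeries ℝ} {ε : ℝ} (hP : coeff 0 P = 0) (hε : 0 ≤ ε) :
    discounted P ε * (C (1 + ε) - P) = 1 := by
  refine PowerSeries.inv_mul_cancel _ ?_
  rw [map_sub, ← coeff_zero_eq_constantCoeff_apply P, hP, constantCoeff_C, sub_zero]
  positivity

namespace RenewalSeries
variable {P F U : PowerSeries ℝ} {ε : ℝ}

theorem coeffNonneg_mass (h : RenewalSeries P F U) : CoeffNonneg U :=
  .of_mul_const_sub one_pos h.coeffNonneg_law h.coeff_zero_law .one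
    (by rw [map_one]; exact h.mass_mul_one_sub)

theorem mass_mul_tail (h : RenewalSeries P F U) : U * F = PowerSeries.mk 1 := by
  have hmass := h.mass_mul_one_sub
  rw [h.one_sub_law] at hmass
  linear_combination PowerSeries.mk 1 * hmass - U * F * mk_one_mul_one_sub_eq_one ℝ

theorem coeffNonneg_discounted (h : RenewalSeries P F U) (hε : 0 ≤ ε) :
    CoeffNonneg (discounted P ε) :=
  .of_mul_const_sub (by positivity) h.coeffNonneg_law h.coeff_zero_law .one
    (discounted_mul h.coeff_zero_law hε)

theorem discounted_mul_one_sub (h : RenewalSeries P F U) (hε : 0 ≤ ε) :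
    discounted P ε * (1 - P) = 1 - C ε * discounted P ε := by
  have hV := discounted_mul h.coeff_zero_law hε
  rw [map_add, map_one] at hV
  linear_combination hV

theorem mass_eq_discounted_add (h : RenewalSeries P F U) (hε : 0 ≤ ε) :
    U = discounted P ε + C ε * U * discounted P ε := by
  linear_combination
    (-U) * h.discounted_mul_one_sub hε + discounted P ε * h.mass_mul_one_sub

theorem coeffNonneg_mass_sub_discounted (h : RenewalSeries P F U) (hε : 0 ≤ ε) :
    CoeffNonneg (U - discounted P ε) := by
  rw [sub_eq_of_eq_add' (h.mass_eq_discounted_add hε)]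
  exact ((CoeffNonneg.const hε).mul h.coeffNonneg_mass).mul (h.coeffNonneg_discounted hε)

theorem coeffNonneg_mk_sub_discounted (h : RenewalSeries P F U) (hε : 0 < ε) :
    CoeffNonneg (C ε⁻¹ * PowerSeries.mk 1 - discounted P ε * PowerSeries.mk 1) := by
  have hV := h.discounted_mul_one_sub hε.le
  rw [h.one_sub_law] at hV
  have hmk : (PowerSeries.mk 1 : PowerSeries ℝ) * (1 - X) = 1 := mk_one_mul_one_sub_eq_one ℝ
  have hC : (C ε⁻¹ : PowerSeries ℝ) * C ε = 1 := by
    rw [← map_mul, inv_mul_cancel₀ hε.ne', map_one]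
  have heq : C ε⁻¹ * PowerSeries.mk 1 - discounted P ε * PowerSeries.mk 1 =
      C ε⁻¹ * (discounted P ε * F) := by
    linear_combination (-C ε⁻¹ * PowerSeries.mk 1) * hV + (C ε⁻¹ * discounted P ε * F) * hmk +
      discounted P ε * PowerSeries.mk 1 * hC
  rw [heq]
  exact (CoeffNonneg.const (inv_pos.2 hε).le).mul
    ((h.coeffNonneg_discounted hε.le).mul h.coeffNonneg_tail)

theorem coeffNonneg_mk_sub_discounted_pow (h : RenewalSeries P F U) (hε : 0 < ε) (i : ℕ) :
    CoeffNonneg (C (ε⁻¹ ^ i) * PowerSeries.mk 1 - discounted P ε ^ i * PowerSeries.mk 1) := by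
  induction i with
  | zero => intro n; simp
  | succ i ih =>
    have heq : C (ε⁻¹ ^ (i + 1)) * PowerSeries.mk 1 - discounted P ε ^ (i + 1) * PowerSeries.mk 1 =
        C ε⁻¹ * (C (ε⁻¹ ^ i) * PowerSeries.mk 1 - discounted P ε ^ i * PowerSeries.mk 1) +
          discounted P ε ^ i * (C ε⁻¹ * PowerSeries.mk 1 - discounted P ε * PowerSeries.mk 1) := by
      rw [pow_succ ε⁻¹, map_mul]
      ring
    rw [heq]
    exact ((CoeffNonneg.const (inv_pos.2 hε).le).mul ih).add
      (((h.coeffNonneg_discounted hε.le).pow i).mul (h.coeffNonneg_mk_sub_discounted hε))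

theorem X_mul_derivative_discounted_pow (h : RenewalSeries P F U) (hε : 0 ≤ ε) (i : ℕ) :
    X * derivative ℝ (discounted P ε ^ (i + 1)) =
      C ((i + 1 : ℕ) : ℝ) * (discounted P ε ^ (i + 2) * (X * derivative ℝ P)) := by
  have hV := discounted_mul h.coeff_zero_law hε
  have hV' := congrArg (derivative ℝ) hV
  rw [Derivation.leibniz, map_sub, derivative_C, Derivation.map_one_eq_zero] at hV'
  simp only [smul_eq_mul] at hV'
  have hderiv : derivative ℝ (discounted P ε) = discounted P ε ^ 2 * derivative ℝ P := by
    linear_combination discounted P ε * hV' - derivative ℝ (discounted P ε) * hV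
  rw [Derivation.leibniz_pow, hderiv]
  simp only [Nat.add_sub_cancel, nsmul_eq_mul, smul_eq_mul, map_natCast]
  ring

/-- Differentiation turns the factor `n` into `n p_n`, which Doney's condition bounds by the
tail. -/
theorem natCast_mul_coeff_discounted_pow_le (h : RenewalSeries P F U) (hε : 0 < ε) {D : ℝ}
    (hD : 0 ≤ D) (hDoney : ∀ n : ℕ, n * coeff n P ≤ D * coeff n F) (i n : ℕ) :
    n * coeff n (discounted P ε ^ (i + 1)) ≤ (i + 1) * (D * ε⁻¹ ^ (i + 1)) := by
  set V := discounted P ε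
  have hV : CoeffNonneg V := h.coeffNonneg_discounted hε.le
  have hderiv : CoeffNonneg (C D * F - X * derivative ℝ P) := fun n => by
    rw [map_sub, coeff_C_mul, coeff_X_mul_derivative]
    exact sub_nonneg.2 (hDoney n)
  have heq : C (D * ε⁻¹ ^ (i + 1)) * PowerSeries.mk 1 - V ^ (i + 2) * (X * derivative ℝ P) =
      V ^ (i + 2) * (C D * F - X * derivative ℝ P) + C D * (V ^ (i + 1) * (U - V) * F) +
        C D * (C (ε⁻¹ ^ (i + 1)) * PowerSeries.mk 1 - V ^ (i + 1) * PowerSeries.mk 1) := by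
    rw [map_mul]
    linear_combination (C D * V ^ (i + 1)) * (-h.mass_mul_tail)
  have hnonneg : 0 ≤
      coeff n (C (D * ε⁻¹ ^ (i + 1)) * PowerSeries.mk 1 - V ^ (i + 2) * (X * derivative ℝ P)) := by
    rw [heq]
    exact ((((hV.pow _).mul hderiv).add ((CoeffNonneg.const hD).mul
      (((hV.pow _).mul (h.coeffNonneg_mass_sub_discounted hε.le)).mul h.coeffNonneg_tail))).add
      ((CoeffNonneg.const hD).mul (h.coeffNonneg_mk_sub_discounted_pow hε _))) n
  rw [map_sub, coeff_C_mul, coeff_mk, Pi.one_apply, mul_one, sub_nonneg] at hnonneg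
  rw [← coeff_X_mul_derivative, h.X_mul_derivative_discounted_pow hε.le, coeff_C_mul,
    Nat.cast_add_one]
  exact mul_le_mul_of_nonneg_left hnonneg (by positivity)

theorem mass_eq_sum_discounted_pow (h : RenewalSeries P F U) (hε : 0 ≤ ε) (M : ℕ) :
    U = ∑ i ∈ Finset.range M, C (ε ^ i) * discounted P ε ^ (i + 1) +
      C (ε ^ M) * (U * discounted P ε ^ M) := by
  induction M with
  | zero => simp
  | succ M ih =>
    rw [Finset.sum_range_succ, pow_succ ε M, map_mul]
    linear_combination ih + (C (ε ^ M) * discounted P ε ^ M) * h.mass_eq_discounted_add hε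

theorem natCast_mul_abs_coeff_mass_sub_le (h : RenewalSeries P F U) (hε : 0 < ε) {D : ℝ}
    (hD : 0 ≤ D) (hDoney : ∀ n : ℕ, n * coeff n P ≤ D * coeff n F) (M n : ℕ) :
    n * |coeff n U - ε ^ M * coeff n (U * discounted P ε ^ M)| ≤
      D * ε⁻¹ * ∑ i ∈ Finset.range M, ((i : ℝ) + 1) := by
  have hcoeff : coeff n U - ε ^ M * coeff n (U * discounted P ε ^ M) =
      ∑ i ∈ Finset.range M, ε ^ i * coeff n (discounted P ε ^ (i + 1)) := by
    have := congrArg (coeff n) (h.mass_eq_sum_discounted_pow hε.le M)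
    simp only [map_add, map_sum, coeff_C_mul] at this
    exact sub_eq_of_eq_add this
  rw [hcoeff, abs_of_nonneg (Finset.sum_nonneg fun i _ => mul_nonneg (pow_nonneg hε.le _)
    ((h.coeffNonneg_discounted hε.le).pow _ _)), Finset.mul_sum, Finset.mul_sum]
  refine Finset.sum_le_sum fun i _ => ?_
  calc n * (ε ^ i * coeff n (discounted P ε ^ (i + 1)))
      = ε ^ i * (n * coeff n (discounted P ε ^ (i + 1))) := by ring
    _ ≤ ε ^ i * ((i + 1) * (D * ε⁻¹ ^ (i + 1))) :=
        mul_le_mul_of_nonneg_left (h.natCast_mul_coeff_discounted_pow_le hε hD hDoney i n)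
          (pow_nonneg hε.le i)
    _ = D * ε⁻¹ * (i + 1) := by
        have hpow : ε ^ i * ε⁻¹ ^ i = 1 := by rw [← mul_pow, mul_inv_cancel₀ hε.ne', one_pow]
        rw [pow_succ]
        linear_combination (i + 1) * D * ε⁻¹ * hpow

end RenewalSeries
end PowerSeries

section Fourier
open PowerSeries

/-- Absolute convergence of a real power series on the closed unit disc. -/
def AbsSummable (A : PowerSeries ℝ) : Prop := Summable fun n => ‖coeff n A‖

/-- The value of a power series at the point `exp (i t)` of the unit circle, which is the
characteristic function at `t` when the coefficients are those of a law on `ℕ`. -/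
noncomputable def circleEval (A : PowerSeries ℝ) (t : ℝ) : ℂ :=
  ∑' n, ((coeff n A : ℝ) : ℂ) * Complex.exp (t * Complex.I) ^ n

theorem norm_ofReal_mul_exp_pow (a t : ℝ) (n : ℕ) :
    ‖(a : ℂ) * Complex.exp (t * Complex.I) ^ n‖ = ‖a‖ := by
  rw [norm_mul, norm_pow, Complex.norm_exp_ofReal_mul_I, one_pow, mul_one, Complex.norm_real]

theorem norm_exp_neg_mul_I (n : ℕ) (t : ℝ) : ‖Complex.exp (-(n * t) * Complex.I)‖ = 1 := by
  exact_mod_cast Complex.norm_exp_ofReal_mul_I (-(n * t))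

theorem integral_exp_pow_mul_exp_neg (k n : ℕ) :
    ∫ t in (-Real.pi)..Real.pi,
      Complex.exp (t * Complex.I) ^ k * Complex.exp (-(n * t) * Complex.I) =
        if k = n then 2 * (Real.pi : ℂ) else 0 := by
  have hexp : ∀ t : ℝ, Complex.exp (t * Complex.I) ^ k * Complex.exp (-(n * t) * Complex.I) =
      Complex.exp ((((k : ℂ) - n) * Complex.I) * t) := fun t => by
    rw [← Complex.exp_nat_mul, ← Complex.exp_add]
    congr 1
    ring
  simp_rw [hexp]
  split_ifs with h
  · subst h
    simp
    ring
  · have hc : ((k : ℂ) - n) * Complex.I ≠ 0 :=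
      mul_ne_zero (sub_ne_zero.2 (by exact_mod_cast h)) Complex.I_ne_zero
    rw [integral_exp_mul_complex hc, div_eq_zero_iff, sub_eq_zero,
      Complex.exp_eq_exp_iff_exists_int]
    refine Or.inl ⟨(k : ℤ) - n, ?_⟩
    push_cast
    ring

theorem coeff_mul_mul_exp_pow (A B : PowerSeries ℝ) (t : ℝ) (n : ℕ) :
    ((coeff n (A * B) : ℝ) : ℂ) * Complex.exp (t * Complex.I) ^ n =
      ∑ x ∈ Finset.HasAntidiagonal.antidiagonal n,
        (((coeff x.1 A : ℝ) : ℂ) * Complex.exp (t * Complex.I) ^ x.1) *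
          (((coeff x.2 B : ℝ) : ℂ) * Complex.exp (t * Complex.I) ^ x.2) := by
  rw [coeff_mul, Complex.ofReal_sum, Finset.sum_mul]
  refine Finset.sum_congr rfl fun x hx => ?_
  rw [← Finset.HasAntidiagonal.mem_antidiagonal.1 hx, pow_add]
  push_cast
  ring

theorem circleEval_const (c t : ℝ) : circleEval (C c) t = c := by
  rw [circleEval, tsum_eq_single 0 fun n hn => by rw [coeff_C, if_neg hn]; simp]
  simp

theorem circleEval_one (t : ℝ) : circleEval 1 t = 1 := by
  rw [← map_one C, circleEval_const, Complex.ofReal_one]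

namespace AbsSummable
variable {A B : PowerSeries ℝ}

theorem summable_norm (hA : AbsSummable A) (t : ℝ) :
    Summable fun n => ‖((coeff n A : ℝ) : ℂ) * Complex.exp (t * Complex.I) ^ n‖ := by
  simp_rw [norm_ofReal_mul_exp_pow]
  exact hA

theorem continuous_circleEval (hA : AbsSummable A) : Continuous (circleEval A) :=
  continuous_tsum (fun n => by fun_prop) hA fun n t => (norm_ofReal_mul_exp_pow _ t n).le

theorem mul (hA : AbsSummable A) (hB : AbsSummable B) : AbsSummable (A * B) := by
  have := summable_norm_sum_mul_antidiagonal_of_summable_norm (hA.summable_norm 0)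
    (hB.summable_norm 0)
  simp_rw [← coeff_mul_mul_exp_pow, norm_ofReal_mul_exp_pow] at this
  exact this

theorem circleEval_mul (hA : AbsSummable A) (hB : AbsSummable B) (t : ℝ) :
    circleEval (A * B) t = circleEval A t * circleEval B t := by
  rw [circleEval, circleEval, circleEval, tsum_mul_tsum_eq_tsum_sum_antidiagonal_of_summable_norm
    (hA.summable_norm t) (hB.summable_norm t)]
  exact tsum_congr fun n => coeff_mul_mul_exp_pow A B t n

theorem const (c : ℝ) : AbsSummable (C c) := by
  refine summable_of_ne_finset_zero (s := {0}) fun n hn => ?_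
  rw [coeff_C, if_neg (by simpa using hn), norm_zero]

theorem one : AbsSummable 1 := by
  rw [← map_one C]
  exact const 1

theorem pow (hA : AbsSummable A) : ∀ k : ℕ, AbsSummable (A ^ k)
  | 0 => by rw [pow_zero]; exact one
  | k + 1 => by rw [pow_succ]; exact (hA.pow k).mul hA

theorem circleEval_pow (hA : AbsSummable A) (t : ℝ) :
    ∀ k : ℕ, circleEval (A ^ k) t = circleEval A t ^ k
  | 0 => by rw [pow_zero, pow_zero, circleEval_one]
  | k + 1 => by rw [pow_succ, (hA.pow k).circleEval_mul hA, pow_succ, hA.circleEval_pow t k]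

theorem sub (hA : AbsSummable A) (hB : AbsSummable B) : AbsSummable (A - B) :=
  Summable.of_nonneg_of_le (fun _ => norm_nonneg _)
    (fun n => by rw [map_sub]; exact norm_sub_le _ _) (Summable.add hA hB)

theorem circleEval_sub (hA : AbsSummable A) (hB : AbsSummable B) (t : ℝ) :
    circleEval (A - B) t = circleEval A t - circleEval B t := by
  rw [circleEval, circleEval, circleEval,
    ← (hA.summable_norm t).of_norm.tsum_sub (hB.summable_norm t).of_norm]
  refine tsum_congr fun n => ?_
  rw [map_sub, Complex.ofReal_sub, sub_mul]

theorem of_sum_range_le (hA : CoeffNonneg A) {c : ℝ}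
    (h : ∀ n, ∑ k ∈ Finset.range n, coeff k A ≤ c) : AbsSummable A :=
  (summable_of_sum_range_le hA h).congr fun n => (Real.norm_of_nonneg (hA n)).symm

theorem integral_circleEval_mul_exp_neg (hA : AbsSummable A) (n : ℕ) :
    ∫ t in (-Real.pi)..Real.pi, circleEval A t * Complex.exp (-(n * t) * Complex.I) =
      2 * Real.pi * coeff n A := by
  have hsum := intervalIntegral.hasSum_integral_of_dominated_convergence (μ := volume)
    (a := -Real.pi) (b := Real.pi)
    (F := fun k (t : ℝ) => ((coeff k A : ℝ) : ℂ) * Complex.exp (t * Complex.I) ^ k *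
      Complex.exp (-(n * t) * Complex.I))
    (f := fun t => circleEval A t * Complex.exp (-(n * t) * Complex.I))
    (fun k _ => ‖coeff k A‖)
    (fun k => Continuous.aestronglyMeasurable (by fun_prop))
    (fun k => ae_of_all _ fun t _ => by
      rw [norm_mul, norm_exp_neg_mul_I, norm_ofReal_mul_exp_pow, mul_one])
    (ae_of_all _ fun t _ => hA) intervalIntegrable_const
    (ae_of_all _ fun t _ => (hA.summable_norm t).of_norm.hasSum.mul_right _)
  rw [← hsum.tsum_eq]
  simp_rw [mul_assoc, intervalIntegral.integral_const_mul, integral_exp_pow_mul_exp_neg]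
  rw [tsum_eq_single n fun k hk => by rw [if_neg hk, mul_zero], if_pos rfl]
  ring

end AbsSummable

theorem norm_le_norm_add_of_re_nonneg {w : ℂ} (hw : 0 ≤ w.re) {κ : ℝ} (hκ : 0 ≤ κ) :
    ‖w‖ ≤ ‖(κ : ℂ) + w‖ := by
  rw [Complex.norm_def, Complex.norm_def, Complex.normSq_apply, Complex.normSq_apply]
  refine Real.sqrt_le_sqrt ?_
  simp only [Complex.add_re, Complex.ofReal_re, Complex.add_im, Complex.ofReal_im, zero_add]
  nlinarith

theorem le_norm_add_of_re_nonneg {w : ℂ} (hw : 0 ≤ w.re) (κ : ℝ) : κ ≤ ‖(κ : ℂ) + w‖ := by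
  refine le_trans ?_ (Complex.re_le_norm _)
  simpa using hw

namespace RenewalSeries
variable {P F U : PowerSeries ℝ} {ε : ℝ}

theorem absSummable_discounted (h : RenewalSeries P F U) (hε : 0 < ε) :
    AbsSummable (discounted P ε) := by
  refine .of_sum_range_le (h.coeffNonneg_discounted hε.le) (c := ε⁻¹) fun n => ?_
  have hsum := h.coeffNonneg_mk_sub_discounted hε n
  rw [map_sub, coeff_C_mul, coeff_mul, Finset.Nat.sum_antidiagonal_eq_sum_range_succ_mk,
    Finset.sum_range_succ] at hsum
  simp only [coeff_mk, Pi.one_apply, mul_one] at hsum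
  linarith [h.coeffNonneg_discounted hε.le n]

theorem circleEval_discounted (h : RenewalSeries P F U) (hP : AbsSummable P) (hε : 0 < ε) (t : ℝ) :
    circleEval (discounted P ε) t = (ε + (1 - circleEval P t))⁻¹ := by
  have hc := AbsSummable.const (1 + ε)
  have hmul := congrArg (circleEval · t) (discounted_mul h.coeff_zero_law hε.le)
  simp only [(h.absSummable_discounted hε).circleEval_mul (hc.sub hP), hc.circleEval_sub hP,
    circleEval_const, circleEval_one] at hmul
  rw [eq_inv_of_mul_eq_one_left hmul]
  push_cast
  ring

theorem coeff_discounted_mul_pow_eq_integral (h : RenewalSeries P F U) (hP : AbsSummable P)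
    {κ : ℝ} (hκ : 0 < κ) (hε : 0 < ε) (M n : ℕ) :
    2 * (Real.pi : ℂ) * coeff n (discounted P κ * discounted P ε ^ M) =
      ∫ t in (-Real.pi)..Real.pi, (κ + (1 - circleEval P t))⁻¹ *
        (ε + (1 - circleEval P t))⁻¹ ^ M * Complex.exp (-(n * t) * Complex.I) := by
  have hWs := h.absSummable_discounted hκ
  have hVs := h.absSummable_discounted hε
  rw [← (hWs.mul (hVs.pow M)).integral_circleEval_mul_exp_neg n]
  refine intervalIntegral.integral_congr fun t _ => ?_
  rw [hWs.circleEval_mul (hVs.pow M), hVs.circleEval_pow, h.circleEval_discounted hP hκ,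
    h.circleEval_discounted hP hε]

theorem tendsto_coeff_discounted_mul (h : RenewalSeries P F U) {B : PowerSeries ℝ}
    (hB : CoeffNonneg B) (n : ℕ) :
    Tendsto (fun κ => coeff n (discounted P κ * B)) (𝓝[>] 0) (𝓝 (coeff n (U * B))) := by
  have hU := h.coeffNonneg_mass
  have hdiff : ∀ κ, 0 < κ →
      coeff n (U * B) - coeff n (discounted P κ * B) ∈ Set.Icc 0 (κ * coeff n (U * U * B)) := by
    intro κ hκ
    have heq : U * B - discounted P κ * B = C κ * (U * discounted P κ * B) := by
      linear_combination B * h.mass_eq_discounted_add hκ.le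
    rw [← map_sub, heq, coeff_C_mul]
    refine ⟨mul_nonneg hκ.le (((hU.mul (h.coeffNonneg_discounted hκ.le)).mul hB) n),
      mul_le_mul_of_nonneg_left (sub_nonneg.1 ?_) hκ.le⟩
    have := ((hU.mul (h.coeffNonneg_mass_sub_discounted hκ.le)).mul hB) n
    rwa [mul_sub, sub_mul, map_sub] at this
  have hzero : Tendsto (fun κ => coeff n (U * B) - coeff n (discounted P κ * B))
      (𝓝[>] 0) (𝓝 0) := by
    refine squeeze_zero' (t₀ := 𝓝[>] 0) (g := fun κ => κ * coeff n (U * U * B)) ?_ ?_ ?_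
    · filter_upwards [self_mem_nhdsWithin] with κ hκ using (hdiff κ hκ).1
    · filter_upwards [self_mem_nhdsWithin] with κ hκ using (hdiff κ hκ).2
    · exact (Continuous.tendsto' (continuous_mul_const _) 0 0 (zero_mul _)).mono_left
        nhdsWithin_le_nhds
  simpa using hzero.const_sub (coeff n (U * B))

/-- The renewal masses themselves need not be summable, so `U` is approximated by discounted
masses, whose discount tends to `0`. -/
theorem coeff_mass_mul_pow_eq_integral (h : RenewalSeries P F U) (hP : AbsSummable P)
    (hint : IntervalIntegrable (fun t => ‖1 - circleEval P t‖⁻¹) volume (-Real.pi) Real.pi)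
    (hne : ∀ t ∈ Set.uIoc (-Real.pi) Real.pi, t ≠ 0 → circleEval P t ≠ 1)
    (hre : ∀ t, 0 ≤ (1 - circleEval P t).re) (hε : 0 < ε) (M n : ℕ) :
    2 * (Real.pi : ℂ) * coeff n (U * discounted P ε ^ M) =
      ∫ t in (-Real.pi)..Real.pi, (1 - circleEval P t)⁻¹ *
        (ε + (1 - circleEval P t))⁻¹ ^ M * Complex.exp (-(n * t) * Complex.I) := by
  have hcoeff : Tendsto
      (fun κ => 2 * (Real.pi : ℂ) * coeff n (discounted P κ * discounted P ε ^ M)) (𝓝[>] 0)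
      (𝓝 (2 * Real.pi * coeff n (U * discounted P ε ^ M))) :=
    ((Complex.continuous_ofReal.tendsto _).comp (h.tendsto_coeff_discounted_mul
      ((h.coeffNonneg_discounted hε.le).pow M) n)).const_mul _
  refine tendsto_nhds_unique_of_eventuallyEq hcoeff ?_ (eventually_nhdsWithin_of_forall
    fun κ hκ => h.coeff_discounted_mul_pow_eq_integral hP hκ hε M n)
  have hne' : ∀ᵐ t, t ∈ Set.uIoc (-Real.pi) Real.pi → 1 - circleEval P t ≠ 0 := by
    filter_upwards [Measure.ae_ne volume (0 : ℝ)] with t ht0 ht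
    exact sub_ne_zero.2 (hne t ht ht0).symm
  refine intervalIntegral.tendsto_integral_filter_of_dominated_convergence
    (fun t => ‖1 - circleEval P t‖⁻¹ * ε⁻¹ ^ M) ?_ ?_ (hint.mul_const _) ?_
  · have := hP.continuous_circleEval.measurable
    exact Eventually.of_forall fun κ => Measurable.aestronglyMeasurable (by fun_prop)
  · refine eventually_nhdsWithin_of_forall fun κ (hκ : 0 < κ) => ?_
    filter_upwards [hne'] with t ht htm
    rw [norm_mul, norm_mul, norm_exp_neg_mul_I, mul_one, norm_inv, norm_pow, norm_inv]
    exact mul_le_mul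
      (inv_anti₀ (norm_pos_iff.2 (ht htm)) (norm_le_norm_add_of_re_nonneg (hre t) hκ.le))
      (pow_le_pow_left₀ (by positivity) (inv_anti₀ hε (le_norm_add_of_re_nonneg (hre t) ε)) _)
      (by positivity) (by positivity)
  · filter_upwards [hne'] with t ht htm
    refine Tendsto.mul_const _ (Tendsto.mul_const _ (Tendsto.inv₀ ?_ (ht htm)))
    exact (Continuous.tendsto' (by fun_prop) 0 _ (by simp)).mono_left nhdsWithin_le_nhds

end RenewalSeries
end Fourier

theorem exists_tendsto_of_forall_norm_sub_le {E : Type*} [SeminormedAddCommGroup E]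
    [CompleteSpace E] {x : ℕ → E}
    (h : ∀ ε > 0, ∃ (y : ℕ → E) (l : E), Tendsto y atTop (𝓝 l) ∧
      ∀ᶠ n in atTop, ‖x n - y n‖ ≤ ε) : ∃ l, Tendsto x atTop (𝓝 l) := by
  refine cauchySeq_tendsto_of_complete (Metric.cauchySeq_iff'.2 fun ε hε => ?_)
  obtain ⟨y, l, hy, hxy⟩ := h (ε / 5) (by positivity)
  obtain ⟨N, hN⟩ := eventually_atTop.1
    ((hy.eventually (Metric.ball_mem_nhds l (show 0 < ε / 5 by positivity))).and hxy)
  refine ⟨N, fun n hn => ?_⟩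
  obtain ⟨hyn, hxyn⟩ := hN n hn
  obtain ⟨hyN, hxyN⟩ := hN N le_rfl
  rw [← dist_eq_norm] at hxyn hxyN
  linarith [dist_triangle4 (x n) (y n) l (x N), dist_triangle_right l (x N) (y N),
    dist_comm l (y N)]

theorem RegularlyVarying.exists_le_mul_rpow_add_rpow {ρ : ℝ} {g : ℕ → ℝ}
    (h : RegularlyVarying ρ g) {γ γ' : ℝ} (hγ0 : 0 ≤ γ) (hγ : ρ < -γ) (hγ' : -γ' < ρ) :
    ∃ K > 0, ∀ m n : ℕ, 1 ≤ m → 1 ≤ n → ∀ x : ℝ, 0 < x → (m : ℝ) ≤ n * x →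
      g n ≤ K * g m * (x ^ γ + x ^ γ') := by
  obtain ⟨C₁, hC₁, hupper⟩ := h.potter_upper hγ
  obtain ⟨C₂, -, hlower⟩ := h.potter_lower hγ'
  refine ⟨max C₁ C₂, lt_max_of_lt_left hC₁, fun m n hm hn x hx hmn => ?_⟩
  have hn0 : (0 : ℝ) < n := by exact_mod_cast hn
  have hgm := h.pos m hm
  have hmnx : (m : ℝ) / n ≤ x := by rwa [div_le_iff₀' hn0]
  rcases le_total m n with hle | hle
  · calc g n ≤ C₁ * g m * ((n : ℝ) / m) ^ (-γ) := hupper m n hm hle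
      _ = C₁ * g m * ((m : ℝ) / n) ^ γ := by
        rw [Real.rpow_neg (by positivity), ← Real.inv_rpow (by positivity), inv_div]
      _ ≤ max C₁ C₂ * g m * (x ^ γ + x ^ γ') := by
        gcongr
        · exact le_max_left _ _
        · exact (Real.rpow_le_rpow (by positivity) hmnx hγ0).trans
            (le_add_of_nonneg_right (by positivity))
  · calc g n ≤ C₂ * g m * ((m : ℝ) / n) ^ γ' := hlower n m hn hle
      _ ≤ max C₁ C₂ * g m * (x ^ γ + x ^ γ') := by
        gcongr
        · exact le_max_right _ _
        · exact (Real.rpow_le_rpow (by positivity) hmnx (by linarith)).trans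
            (le_add_of_nonneg_left (by positivity))

theorem cos_le_cos_one {x : ℝ} (h1 : 1 ≤ x) (h4 : x ≤ 4) :
    Real.cos x ≤ Real.cos 1 := by
  rcases le_total x Real.pi with h | h
  · exact Real.cos_le_cos_of_nonneg_of_le_pi zero_le_one h h1
  · have hpi := Real.pi_gt_three
    exact (Real.cos_nonpos_of_pi_div_two_le_of_le (by linarith) (by linarith)).trans
      Real.cos_one_pos.le

theorem exp_mul_I_pow_re (t : ℝ) (n : ℕ) :
    (Complex.exp (t * Complex.I) ^ n).re = Real.cos (n * t) := by
  rw [← Complex.exp_nat_mul, ← mul_assoc]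
  exact_mod_cast Complex.exp_ofReal_mul_I_re (n * t)

theorem exp_mul_I_pow_eq_one_of_cos_eq_one {t : ℝ} {n : ℕ} (h : Real.cos (n * t) = 1) :
    Complex.exp (t * Complex.I) ^ n = 1 := by
  have hre := (exp_mul_I_pow_re t n).trans h
  refine Complex.ext hre (Complex.abs_re_eq_norm.1 ?_)
  rw [hre, norm_pow, Complex.norm_exp_ofReal_mul_I, one_pow, abs_one]

theorem eq_zero_of_exp_mul_I_eq_one {t : ℝ} (ht : |t| ≤ Real.pi)
    (h : Complex.exp (t * Complex.I) = 1) : t = 0 := by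
  rw [abs_le] at ht
  refine (Real.cos_eq_one_iff_of_lt_of_lt (by linarith [Real.pi_pos])
    (by linarith [Real.pi_pos])).1 ?_
  rw [← Complex.exp_ofReal_mul_I_re, h, Complex.one_re]

/-- `p` is an aperiodic probability mass function on the positive integers whose tail
`f n = ∑ k > n, p k` is regularly varying of index `-β` with `0 < β < 1`. -/
structure RegVarLaw (β : ℝ) (p f : ℕ → ℝ) : Prop where
  index_pos : 0 < β
  index_lt_one : β < 1
  law_zero : p 0 = 0
  law_succ : ∀ n, p (n + 1) = f n - f (n + 1)
  tail_zero : f 0 = 1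
  antitone : Antitone f
  regularlyVarying : RegularlyVarying (-β) f
  aperiodic : ∀ d : ℕ, (∀ n, 0 < p n → d ∣ n) → d = 1

namespace RegVarLaw
variable {β : ℝ} {p f : ℕ → ℝ}

theorem tail_pos (h : RegVarLaw β p f) (n : ℕ) : 0 < f n := by
  rcases Nat.eq_zero_or_pos n with rfl | hn
  · rw [h.tail_zero]
    exact one_pos
  · exact h.regularlyVarying.pos n hn

theorem law_nonneg (h : RegVarLaw β p f) (n : ℕ) : 0 ≤ p n := by
  cases n with
  | zero => rw [h.law_zero]
  | succ n =>
    rw [h.law_succ]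
    exact sub_nonneg.2 (h.antitone n.le_succ)

theorem tail_le_one (h : RegVarLaw β p f) (n : ℕ) : f n ≤ 1 :=
  h.tail_zero ▸ h.antitone n.zero_le

theorem sum_range_succ (h : RegVarLaw β p f) (n : ℕ) :
    ∑ k ∈ Finset.range (n + 1), p k = 1 - f n := by
  induction n with
  | zero => simp [h.law_zero, h.tail_zero]
  | succ n ih => rw [Finset.sum_range_succ, ih, h.law_succ]; ring

theorem sum_Ioc (h : RegVarLaw β p f) {k n : ℕ} (hkn : k ≤ n) :
    ∑ j ∈ Finset.Ioc k n, p j = f k - f n := by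
  induction n, hkn using Nat.le_induction with
  | base => simp
  | succ n hn ih => rw [Finset.sum_Ioc_succ_top hn, ih, h.law_succ]; ring

theorem hasSum_law (h : RegVarLaw β p f) : HasSum p 1 := by
  rw [hasSum_iff_tendsto_nat_of_nonneg h.law_nonneg, ← tendsto_add_atTop_iff_nat 1]
  simp_rw [h.sum_range_succ]
  simpa using (h.regularlyVarying.tendsto_zero (neg_lt_zero.2 h.index_pos)).const_sub 1

theorem absSummable (h : RegVarLaw β p f) : AbsSummable (PowerSeries.mk p) := by
  refine .of_sum_range_le (fun n => ?_) (c := 1) fun n => ?_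
  · rw [PowerSeries.coeff_mk]
    exact h.law_nonneg n
  · simp_rw [PowerSeries.coeff_mk]
    exact sum_le_hasSum _ (fun k _ => h.law_nonneg k) h.hasSum_law

theorem hasSum_one_sub (h : RegVarLaw β p f) (t : ℝ) :
    HasSum (fun n => (p n : ℂ) * (1 - Complex.exp (t * Complex.I) ^ n))
      (1 - circleEval (PowerSeries.mk p) t) := by
  have hone : HasSum (fun n => (p n : ℂ)) 1 := by simpa using Complex.hasSum_ofReal.2 h.hasSum_law
  refine (hone.sub (h.absSummable.summable_norm t).of_norm.hasSum).congr_fun fun n => ?_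
  rw [PowerSeries.coeff_mk]
  ring

theorem hasSum_one_sub_cos (h : RegVarLaw β p f) (t : ℝ) :
    HasSum (fun n => p n * (1 - Real.cos (n * t)))
      (1 - circleEval (PowerSeries.mk p) t).re := by
  refine (Complex.hasSum_re (h.hasSum_one_sub t)).congr_fun fun n => ?_
  rw [Complex.re_ofReal_mul, Complex.sub_re, exp_mul_I_pow_re, Complex.one_re]

theorem law_mul_one_sub_cos_nonneg (h : RegVarLaw β p f) (t : ℝ) (n : ℕ) :
    0 ≤ p n * (1 - Real.cos (n * t)) :=
  mul_nonneg (h.law_nonneg n) (sub_nonneg.2 (Real.cos_le_one _))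

theorem one_sub_circleEval_re_nonneg (h : RegVarLaw β p f) (t : ℝ) :
    0 ≤ (1 - circleEval (PowerSeries.mk p) t).re :=
  (h.hasSum_one_sub_cos t).nonneg (h.law_mul_one_sub_cos_nonneg t)

theorem circleEval_ne_one (h : RegVarLaw β p f) {t : ℝ} (ht : |t| ≤ Real.pi) (ht0 : t ≠ 0) :
    circleEval (PowerSeries.mk p) t ≠ 1 := by
  intro heq
  have hzero := h.hasSum_one_sub_cos t
  rw [heq, sub_self, Complex.zero_re,
    hasSum_zero_iff_of_nonneg (h.law_mul_one_sub_cos_nonneg t)] at hzero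
  refine ht0 (eq_zero_of_exp_mul_I_eq_one ht (orderOf_eq_one_iff.1 (h.aperiodic _ fun n hn => ?_)))
  have hcos := congrFun hzero n
  rw [Pi.zero_apply, mul_eq_zero, or_iff_right hn.ne', sub_eq_zero] at hcos
  exact orderOf_dvd_of_pow_eq_one (exp_mul_I_pow_eq_one_of_cos_eq_one hcos.symm)

theorem exists_le_norm_one_sub_circleEval (h : RegVarLaw β p f) {δ : ℝ} (hδ : 0 < δ) :
    ∃ c > 0, ∀ t : ℝ, δ ≤ |t| → |t| ≤ Real.pi → c ≤ ‖1 - circleEval (PowerSeries.mk p) t‖ := by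
  have hcompact : IsCompact {t : ℝ | δ ≤ |t| ∧ |t| ≤ Real.pi} :=
    (isCompact_Icc (a := -Real.pi) (b := Real.pi)).of_isClosed_subset
      ((isClosed_le continuous_const continuous_abs).inter
        (isClosed_le continuous_abs continuous_const)) fun t ht => abs_le.1 ht.2
  have hcont := h.absSummable.continuous_circleEval
  obtain ⟨c, hc, hle⟩ := hcompact.exists_forall_le' (a := (0 : ℝ))
    (f := fun t => ‖1 - circleEval (PowerSeries.mk p) t‖) (by fun_prop) fun t ht =>
      norm_pos_iff.2 (sub_ne_zero.2
        (h.circleEval_ne_one ht.2 (abs_pos.1 (hδ.trans_le ht.1))).symm)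
  exact ⟨c, hc, fun t ht htpi => hle t ⟨ht, htpi⟩⟩

/-- The terms `k < j ≤ 2 k` alone account for the lower bound, since `1 ≤ j |t| ≤ 4` there. -/
theorem one_sub_cos_one_mul_le (h : RegVarLaw β p f) {t : ℝ} {k : ℕ} (hk1 : 1 ≤ k * |t|)
    (hk2 : k * |t| ≤ 2) :
    (1 - Real.cos 1) * (f k - f (2 * k)) ≤ ‖1 - circleEval (PowerSeries.mk p) t‖ :=
  calc (1 - Real.cos 1) * (f k - f (2 * k))
      = ∑ j ∈ Finset.Ioc k (2 * k), p j * (1 - Real.cos 1) := by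
        rw [← h.sum_Ioc (by lia), ← Finset.sum_mul, mul_comm]
    _ ≤ ∑ j ∈ Finset.Ioc k (2 * k), p j * (1 - Real.cos (j * t)) := by
        refine Finset.sum_le_sum fun j hj => mul_le_mul_of_nonneg_left
          (sub_le_sub_left ?_ 1) (h.law_nonneg j)
        have hkj : (k : ℝ) ≤ j := by exact_mod_cast (Finset.mem_Ioc.1 hj).1.le
        have hjk : (j : ℝ) ≤ 2 * k := by exact_mod_cast (Finset.mem_Ioc.1 hj).2
        rw [← Real.cos_abs (j * t), abs_mul, Nat.abs_cast]
        exact cos_le_cos_one (by nlinarith [abs_nonneg t]) (by nlinarith [abs_nonneg t])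
    _ ≤ (1 - circleEval (PowerSeries.mk p) t).re :=
        sum_le_hasSum _ (fun j _ => h.law_mul_one_sub_cos_nonneg t j) (h.hasSum_one_sub_cos t)
    _ ≤ ‖1 - circleEval (PowerSeries.mk p) t‖ := Complex.re_le_norm _

theorem exists_tail_two_mul_le (h : RegVarLaw β p f) :
    ∃ r < 1, ∀ᶠ n in atTop, f (2 * n) ≤ r * f n := by
  have hlim : Tendsto (fun n => f (2 * n) / f n) atTop (𝓝 (((2 : ℕ) : ℝ) ^ (-β))) :=
    (h.regularlyVarying.tendsto_ratio (2 : ℕ) (by norm_num)).comp (tendsto_mul_ratioFilter 2)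
  obtain ⟨r, hr, hr1⟩ := exists_between (show ((2 : ℕ) : ℝ) ^ (-β) < 1 from
    Real.rpow_lt_one_of_one_lt_of_neg (by norm_num) (neg_lt_zero.2 h.index_pos))
  refine ⟨r, hr1, ?_⟩
  filter_upwards [hlim.eventually_le_const hr] with n hn
  rwa [div_le_iff₀ (h.tail_pos n)] at hn

theorem exists_mul_tail_ceil_le (h : RegVarLaw β p f) :
    ∃ c > 0, ∀ t : ℝ, t ≠ 0 → |t| ≤ Real.pi →
      c * f ⌈1 / |t|⌉₊ ≤ ‖1 - circleEval (PowerSeries.mk p) t‖ := by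
  obtain ⟨r, hr, hhalf⟩ := h.exists_tail_two_mul_le
  obtain ⟨K, hK⟩ := eventually_atTop.1 hhalf
  obtain ⟨c, hc, hfar⟩ := h.exists_le_norm_one_sub_circleEval
    (show (0 : ℝ) < 1 / ((K : ℝ) + 1) by positivity)
  have hcos : 0 < 1 - Real.cos 1 := by linarith [Real.cos_one_le]
  refine ⟨min c ((1 - Real.cos 1) * (1 - r)), lt_min hc (mul_pos hcos (by linarith)),
    fun t ht htpi => ?_⟩
  have htpos : 0 < |t| := abs_pos.2 ht
  set k := ⌈1 / |t|⌉₊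
  have hfk := h.tail_pos k
  rcases le_or_gt (1 / ((K : ℝ) + 1)) |t| with hfar_t | hnear
  · calc min c ((1 - Real.cos 1) * (1 - r)) * f k ≤ c * 1 :=
          mul_le_mul (min_le_left _ _) (h.tail_le_one k) hfk.le hc.le
      _ ≤ ‖1 - circleEval (PowerSeries.mk p) t‖ := by
          rw [mul_one]
          exact hfar t hfar_t htpi
  · have hK1 : (K : ℝ) + 1 < 1 / |t| := by rwa [lt_one_div (by positivity) htpos]
    have hk_ge : 1 / |t| ≤ k := Nat.le_ceil _
    have hk_lt : (k : ℝ) < 1 / |t| + 1 := Nat.ceil_lt_add_one (by positivity)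
    have hKk : K ≤ k := by exact_mod_cast (by linarith : (K : ℝ) ≤ k)
    have hk2 : (k : ℝ) ≤ 2 / |t| := by
      rw [← one_add_one_eq_two, add_div]
      linarith [Nat.cast_nonneg (α := ℝ) K]
    calc min c ((1 - Real.cos 1) * (1 - r)) * f k
        ≤ (1 - Real.cos 1) * (1 - r) * f k := by
          gcongr
          exact min_le_right _ _
      _ = (1 - Real.cos 1) * (f k - r * f k) := by ring
      _ ≤ (1 - Real.cos 1) * (f k - f (2 * k)) := by
          gcongr
          exact hK k hKk
      _ ≤ ‖1 - circleEval (PowerSeries.mk p) t‖ :=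
          h.one_sub_cos_one_mul_le ((div_le_iff₀ htpos).1 hk_ge) ((le_div_iff₀ htpos).1 hk2)

theorem exists_mul_norm_inv_le (h : RegVarLaw β p f) {γ γ' : ℝ} (hγ0 : 0 ≤ γ) (hγ : γ < β)
    (hγ' : β < γ') :
    ∃ K > 0, ∀ n : ℕ, 1 ≤ n → ∀ s : ℝ, s ≠ 0 → |s| ≤ n * Real.pi →
      f n * ‖1 - circleEval (PowerSeries.mk p) (s / n)‖⁻¹ ≤ K * (|s| ^ (-γ) + |s| ^ (-γ')) := by
  obtain ⟨c, hc, hlower⟩ := h.exists_mul_tail_ceil_le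
  obtain ⟨K, hK, hpotter⟩ := h.regularlyVarying.exists_le_mul_rpow_add_rpow hγ0
    (neg_lt_neg hγ) (neg_lt_neg hγ')
  set A := (1 + Real.pi) ^ γ + (1 + Real.pi) ^ γ' with hA
  refine ⟨c⁻¹ * K * A, by positivity, fun n hn s hs hsn => ?_⟩
  have hn0 : (0 : ℝ) < n := by exact_mod_cast hn
  have hs0 : 0 < |s| := abs_pos.2 hs
  have habs : |s / n| = |s| / n := by rw [abs_div, Nat.abs_cast]
  have hlow := hlower (s / n) (div_ne_zero hs hn0.ne') (by rwa [habs, div_le_iff₀' hn0])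
  rw [habs, one_div_div] at hlow
  set k := ⌈(n : ℝ) / |s|⌉₊
  have hk : (k : ℝ) ≤ n * ((1 + Real.pi) / |s|) := by
    have hone : 1 ≤ n * Real.pi / |s| := by rwa [one_le_div hs0]
    calc (k : ℝ) ≤ n / |s| + 1 := (Nat.ceil_lt_add_one (by positivity)).le
      _ ≤ n / |s| + n * Real.pi / |s| := by gcongr
      _ = n * ((1 + Real.pi) / |s|) := by ring
  have hpow : ((1 + Real.pi) / |s|) ^ γ + ((1 + Real.pi) / |s|) ^ γ' ≤
      A * (|s| ^ (-γ) + |s| ^ (-γ')) := by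
    rw [Real.div_rpow (by positivity) hs0.le, Real.div_rpow (by positivity) hs0.le, div_eq_mul_inv,
      div_eq_mul_inv, ← Real.rpow_neg hs0.le, ← Real.rpow_neg hs0.le, hA]
    have hcross : 0 ≤ (1 + Real.pi) ^ γ * |s| ^ (-γ') + (1 + Real.pi) ^ γ' * |s| ^ (-γ) := by
      positivity
    linarith
  have hfk := h.tail_pos k
  rw [← div_eq_mul_inv, div_le_iff₀ ((mul_pos hc hfk).trans_le hlow)]
  calc f n ≤ K * f k * (A * (|s| ^ (-γ) + |s| ^ (-γ'))) :=
        (hpotter k n (Nat.one_le_ceil_iff.2 (by positivity)) hn _ (by positivity) hk).trans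
          (by gcongr)
    _ = c⁻¹ * K * A * (|s| ^ (-γ) + |s| ^ (-γ')) * (c * f k) := by field_simp
    _ ≤ c⁻¹ * K * A * (|s| ^ (-γ) + |s| ^ (-γ')) *
        ‖1 - circleEval (PowerSeries.mk p) (s / n)‖ := by gcongr

end RegVarLaw

theorem norm_one_sub_exp_pow_le (t : ℝ) (n : ℕ) : ‖1 - Complex.exp (t * Complex.I) ^ n‖ ≤ 2 := by
  refine (norm_sub_le _ _).trans ?_
  rw [norm_one, norm_pow, Complex.norm_exp_ofReal_mul_I, one_pow]
  norm_num

theorem exp_div_mul_I_pow (s : ℝ) (n k : ℕ) :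
    Complex.exp (((s / n : ℝ) : ℂ) * Complex.I) ^ k
      = Complex.exp (((s * (k / n) : ℝ) : ℂ) * Complex.I) := by
  rw [← Complex.exp_nat_mul]
  congr 1
  push_cast
  ring

theorem tendsto_natCast_mul_one_sub_exp (s : ℝ) :
    Tendsto (fun n : ℕ => (n : ℂ) * (1 - Complex.exp (((s / n : ℝ) : ℂ) * Complex.I))) atTop
      (𝓝 (-(s * Complex.I))) := by
  have hderiv : HasDerivAt (fun x : ℝ => Complex.exp (((s * x : ℝ) : ℂ) * Complex.I))
      (s * Complex.I) 0 := by
    have hlin : HasDerivAt (fun x : ℝ => ((s * x : ℝ) : ℂ) * Complex.I) (s * Complex.I) 0 := by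
      simpa using ((hasDerivAt_id (0 : ℝ)).const_mul s).ofReal_comp.mul_const Complex.I
    simpa using hlin.cexp
  have hinv : Tendsto (fun n : ℕ => (n : ℝ)⁻¹) atTop (𝓝[≠] 0) := by
    refine tendsto_nhdsWithin_iff.2 ⟨tendsto_inv_atTop_zero.comp tendsto_natCast_atTop_atTop, ?_⟩
    filter_upwards [eventually_ge_atTop 1] with n hn
    exact inv_ne_zero (Nat.cast_ne_zero.2 (by omega))
  refine (hderiv.tendsto_slope.comp hinv).neg.congr fun n => ?_
  simp only [Function.comp, slope, sub_zero, inv_inv, mul_zero, vsub_eq_sub, Complex.ofReal_zero,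
    zero_mul, Complex.exp_zero, Complex.real_smul, Complex.ofReal_natCast, div_eq_mul_inv]
  ring

/-- The characteristic exponent `1 - E[exp(i s Y / n)]` of the law `p`, rescaled by its tail `f n`.
It converges as `n → ∞`, to the exponent of a stable law, although only convergence is used. -/
noncomputable def scaledExponent (p f : ℕ → ℝ) (n : ℕ) (s : ℝ) : ℂ :=
  (1 - circleEval (PowerSeries.mk p) (s / n)) / f n

theorem RegularlyVarying.tendsto_riemann_sum_mul_exp {ρ : ℝ} {g : ℕ → ℝ}
    (h : RegularlyVarying ρ g) (hρ : -1 < ρ) (hg : Antitone g) (s : ℝ) (M : ℕ) :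
    Tendsto (fun n : ℕ => (n : ℝ)⁻¹ • ∑ k ∈ Finset.Ico 1 (n * M),
        ((g k / g n : ℝ) : ℂ) * Complex.exp (((s / n : ℝ) : ℂ) * Complex.I) ^ k) atTop
      (𝓝 (∫ x in (0 : ℝ)..M,
        ((x ^ ρ : ℝ) : ℂ) * Complex.exp (((s * x : ℝ) : ℂ) * Complex.I))) := by
  obtain ⟨γ, C, -, hγ1, hC, hle⟩ := h.exists_div_le hρ
  refine tendsto_riemann_sum (b := fun x => C * x ^ (-γ) + 1) ?_ (fun n x hx hn hk => ?_)
    fun x hx => Tendsto.mul ?_ ?_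
  · rcases M.eq_zero_or_pos with rfl | hM
    · simp
    · refine Integrable.add (Integrable.const_mul ?_ _) (integrableOn_const (by simp))
      exact (intervalIntegral.integrableOn_Ioo_rpow_iff (by exact_mod_cast hM)).2 (by linarith)
  · have hgn := h.pos n hn
    have hgk := h.pos _ hk
    have hx0 : 0 < x := hx.1
    rw [norm_ofReal_mul_exp_pow, Real.norm_of_nonneg (by positivity)]
    rcases le_total ⌊(n : ℝ) * x⌋₊ n with hkn | hkn
    · have hfloor : n * x ≤ 2 * ⌊(n : ℝ) * x⌋₊ := by
        have : (1 : ℝ) ≤ ⌊(n : ℝ) * x⌋₊ := by exact_mod_cast hk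
        linarith [Nat.lt_floor_add_one ((n : ℝ) * x)]
      linarith [hle _ n x hk hkn hx0 hfloor]
    · have : 0 ≤ C * x ^ (-γ) := by positivity
      linarith [(div_le_one hgn).2 (hg hkn)]
  · exact (Complex.continuous_ofReal.tendsto _).comp
      ((h.tendsto_ratio x hx.1).comp (tendsto_floor_mul_ratioFilter hx.1.le))
  · have hcont : Continuous fun y : ℝ => Complex.exp (((s * y : ℝ) : ℂ) * Complex.I) := by
      fun_prop
    exact ((hcont.tendsto x).comp (tendsto_floor_mul_div hx.1.le)).congr fun n =>
      (exp_div_mul_I_pow s n _).symm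

namespace RegVarLaw
variable {β : ℝ} {p f : ℕ → ℝ}

theorem sum_mul_one_sub_pow (h : RegVarLaw β p f) (z : ℂ) (N : ℕ) :
    ∑ k ∈ Finset.range (N + 1), (p k : ℂ) * (1 - z ^ k) + f N * (1 - z ^ N)
      = (1 - z) * ∑ k ∈ Finset.range N, (f k : ℂ) * z ^ k := by
  induction N with
  | zero => simp
  | succ N ih =>
    rw [Finset.sum_range_succ _ (N + 1), Finset.sum_range_succ (fun k => (f k : ℂ) * z ^ k),
      h.law_succ]
    push_cast
    linear_combination ih

theorem norm_one_sub_circleEval_sub_le (h : RegVarLaw β p f) (t : ℝ) (N : ℕ) :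
    ‖(1 - circleEval (PowerSeries.mk p) t) - (1 - Complex.exp (t * Complex.I))
      * ∑ k ∈ Finset.range N, (f k : ℂ) * Complex.exp (t * Complex.I) ^ k‖ ≤ 4 * f N := by
  have hlaw : HasSum (fun k => p (k + (N + 1))) (f N) := by
    have := (hasSum_nat_add_iff' (N + 1)).2 h.hasSum_law
    rwa [h.sum_range_succ, sub_sub_cancel] at this
  have htail : ‖(1 - circleEval (PowerSeries.mk p) t)
        - ∑ k ∈ Finset.range (N + 1), (p k : ℂ) * (1 - Complex.exp (t * Complex.I) ^ k)‖
      ≤ 2 * f N := by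
    refine ((hasSum_nat_add_iff' (N + 1)).2 (h.hasSum_one_sub t)).norm_le_of_bounded
      (hlaw.mul_left 2) fun k => ?_
    rw [norm_mul, Complex.norm_real, Real.norm_of_nonneg (h.law_nonneg _), mul_comm]
    exact mul_le_mul_of_nonneg_right (norm_one_sub_exp_pow_le t _) (h.law_nonneg _)
  have hboundary : ‖(f N : ℂ) * (1 - Complex.exp (t * Complex.I) ^ N)‖ ≤ 2 * f N := by
    rw [norm_mul, Complex.norm_real, Real.norm_of_nonneg (h.tail_pos _).le, mul_comm]
    exact mul_le_mul_of_nonneg_right (norm_one_sub_exp_pow_le t _) (h.tail_pos _).le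
  rw [← h.sum_mul_one_sub_pow, ← sub_sub]
  exact (norm_sub_le _ _).trans (by linarith)

theorem exists_tendsto_inv_mul_sum (h : RegVarLaw β p f) (s : ℝ) {M : ℕ} (hM : 0 < M) :
    ∃ l : ℂ, Tendsto (fun n : ℕ => (n : ℂ)⁻¹ * ((f n : ℂ)⁻¹ * ∑ k ∈ Finset.range (n * M),
      (f k : ℂ) * Complex.exp (((s / n : ℝ) : ℂ) * Complex.I) ^ k)) atTop (𝓝 l) := by
  have hzero : Tendsto (fun n : ℕ => (((n * f n)⁻¹ : ℝ) : ℂ)) atTop (𝓝 ((0 : ℝ) : ℂ)) :=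
    (Complex.continuous_ofReal.tendsto _).comp
      (h.regularlyVarying.inv_natCast_mul.tendsto_zero (by linarith [h.index_lt_one]))
  refine ⟨_, ((h.regularlyVarying.tendsto_riemann_sum_mul_exp (neg_lt_neg h.index_lt_one)
    h.antitone s M).add hzero).congr' ?_⟩
  filter_upwards [eventually_ge_atTop 1] with n hn
  rw [Finset.range_eq_Ico, Finset.sum_eq_sum_Ico_succ_bot (Nat.mul_pos hn hM),
    h.tail_zero, pow_zero, zero_add, Complex.real_smul, mul_add, mul_add, add_comm]
  push_cast
  congr 1
  · rw [mul_inv]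
    ring
  · rw [Finset.mul_sum (Finset.Ico 1 (n * M)) _ (f n : ℂ)⁻¹]
    congr 1
    exact Finset.sum_congr rfl fun k _ => by ring

theorem exists_tendsto_scaledExponent (h : RegVarLaw β p f) (s : ℝ) :
    ∃ l : ℂ, Tendsto (fun n => scaledExponent p f n s) atTop (𝓝 l) := by
  refine exists_tendsto_of_forall_norm_sub_le fun ε hε => ?_
  have hzero : Tendsto (fun M : ℕ => 4 * (M : ℝ) ^ (-β)) atTop (𝓝 0) := by
    simpa using ((tendsto_rpow_neg_atTop h.index_pos).comp tendsto_natCast_atTop_atTop).const_mul 4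
  obtain ⟨M, hMε, hM⟩ := ((hzero.eventually_lt_const hε).and (eventually_gt_atTop 0)).exists
  obtain ⟨l, hl⟩ := h.exists_tendsto_inv_mul_sum s hM
  refine ⟨_, _, (tendsto_natCast_mul_one_sub_exp s).mul hl, ?_⟩
  have hratio : Tendsto (fun n => 4 * (f (M * n) / f n)) atTop (𝓝 (4 * (M : ℝ) ^ (-β))) :=
    ((h.regularlyVarying.tendsto_ratio M (by exact_mod_cast hM)).comp
      (tendsto_mul_ratioFilter M)).const_mul 4
  filter_upwards [hratio.eventually_lt_const hMε, eventually_ge_atTop 1] with n hn hn1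
  have hn0 : (n : ℂ) ≠ 0 := Nat.cast_ne_zero.2 (by omega)
  have hfn := h.tail_pos n
  have hfactor (w z S : ℂ) : w / f n - n * z * ((n : ℂ)⁻¹ * ((f n : ℂ)⁻¹ * S))
      = (w - z * S) / f n := by
    field_simp
  rw [scaledExponent, hfactor, norm_div, Complex.norm_real, Real.norm_of_nonneg hfn.le]
  calc _ ≤ 4 * f (n * M) / f n := by gcongr; exact h.norm_one_sub_circleEval_sub_le _ _
    _ = 4 * (f (M * n) / f n) := by rw [mul_comm n, mul_div_assoc]
    _ ≤ ε := hn.le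

end RegVarLaw

section StrongRenewal
open PowerSeries

theorem intervalIntegrable_abs_rpow {r : ℝ} (hr : -1 < r) (a b : ℝ) :
    IntervalIntegrable (fun x : ℝ => |x| ^ r) volume a b := by
  refine intervalIntegrable_of_even (fun x => by rw [abs_neg]) (fun x hx => ?_) enorm_ne_top
    enorm_ne_top
  refine (intervalIntegral.intervalIntegrable_rpow' hr).congr fun t ht => ?_
  rw [Set.uIoc_of_le hx.le] at ht
  rw [abs_of_pos ht.1]

theorem integrable_ite_abs_rpow {A B a q : ℝ} (ha : a < 1) (hq : 1 < q) :
    Integrable (fun s : ℝ => if |s| ≤ 1 then A * |s| ^ (-a) else B * |s| ^ (-q)) := by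
  have hradial := (integrable_fun_norm_addHaar (volume : Measure ℝ)
    (f := fun x : ℝ => if x ≤ 1 then A * x ^ (-a) else B * x ^ (-q))).2
  simp only [Module.finrank_self, Nat.sub_self, pow_zero, one_smul, Real.norm_eq_abs] at hradial
  refine hradial ?_
  rw [← Set.Ioc_union_Ioi_eq_Ioi (zero_le_one (α := ℝ))]
  refine IntegrableOn.union ?_ ?_
  · have hnear : IntegrableOn (fun x : ℝ => A * x ^ (-a)) (Set.Ioc 0 1) := by
      refine Integrable.const_mul ?_ A
      rw [← IntegrableOn, integrableOn_Ioc_iff_integrableOn_Ioo,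
        intervalIntegral.integrableOn_Ioo_rpow_iff one_pos]
      linarith
    exact hnear.congr_fun (fun x hx => (if_pos hx.2).symm) measurableSet_Ioc
  · have hfar : IntegrableOn (fun x : ℝ => B * x ^ (-q)) (Set.Ioi 1) :=
      Integrable.const_mul (integrableOn_Ioi_rpow_of_lt (by linarith) one_pos) B
    exact hfar.congr_fun (fun x hx => (if_neg (not_le.2 hx)).symm) measurableSet_Ioi

/-- `stableKernel δ M w = w⁻¹ (1 + δ w)⁻ᴹ`: evaluated at the rescaled characteristic exponent, this
is the Fourier transform of the renewal mass damped by `M` discounted renewal measures. -/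
noncomputable def stableKernel (δ : ℝ) (M : ℕ) (w : ℂ) : ℂ := w⁻¹ * (1 + δ * w)⁻¹ ^ M

theorem one_le_norm_one_add_mul {δ : ℝ} (hδ : 0 ≤ δ) {w : ℂ} (hw : 0 ≤ w.re) :
    1 ≤ ‖1 + δ * w‖ := by
  have hre : 0 ≤ ((δ : ℂ) * w).re := by
    rw [Complex.re_ofReal_mul]
    exact mul_nonneg hδ hw
  simpa using le_norm_add_of_re_nonneg hre 1

theorem norm_stableKernel_le {δ : ℝ} (hδ : 0 ≤ δ) {w : ℂ} (hw : 0 ≤ w.re) (M : ℕ) :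
    ‖stableKernel δ M w‖ ≤ ‖w⁻¹‖ := by
  rw [stableKernel, norm_mul, norm_pow, norm_inv (1 + _)]
  exact mul_le_of_le_one_right (norm_nonneg _)
    (pow_le_one₀ (by positivity) (inv_le_one_of_one_le₀ (one_le_norm_one_add_mul hδ hw)))

theorem norm_stableKernel_le_pow {δ : ℝ} (hδ : 0 < δ) {w : ℂ} (hw : 0 ≤ w.re) (M : ℕ) :
    ‖stableKernel δ M w‖ ≤ δ⁻¹ ^ M * ‖w⁻¹‖ ^ (M + 1) := by
  rcases eq_or_ne w 0 with rfl | hw0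
  · simp [stableKernel]
  have hre : 0 ≤ ((δ : ℂ) * w).re := by
    rw [Complex.re_ofReal_mul]
    exact mul_nonneg hδ.le hw
  have hle : ‖(1 + δ * w)⁻¹‖ ≤ δ⁻¹ * ‖w⁻¹‖ := by
    rw [norm_inv, norm_inv, ← mul_inv]
    refine inv_anti₀ (mul_pos hδ (norm_pos_iff.2 hw0)) ?_
    simpa [abs_of_pos hδ] using norm_le_norm_add_of_re_nonneg hre zero_le_one
  calc ‖stableKernel δ M w‖ = ‖w⁻¹‖ * ‖(1 + δ * w)⁻¹‖ ^ M := by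
        rw [stableKernel, norm_mul, norm_pow]
    _ ≤ ‖w⁻¹‖ * (δ⁻¹ * ‖w⁻¹‖) ^ M := by gcongr
    _ = δ⁻¹ ^ M * ‖w⁻¹‖ ^ (M + 1) := by ring

theorem norm_stableKernel_le_ite {δ K a b s : ℝ} (hδ : 0 < δ) (hK : 0 ≤ K) (hab : a ≤ b)
    (hs : s ≠ 0) {w : ℂ} (hw : 0 ≤ w.re) (hle : ‖w⁻¹‖ ≤ K * (|s| ^ (-a) + |s| ^ (-b))) (M : ℕ) :
    ‖stableKernel δ M w‖ ≤ if |s| ≤ 1 then 2 * K * |s| ^ (-b)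
      else δ⁻¹ ^ M * (2 * K) ^ (M + 1) * |s| ^ (-(a * (M + 1 : ℕ))) := by
  have hs0 : 0 < |s| := abs_pos.2 hs
  split_ifs with hs1
  · have : |s| ^ (-a) ≤ |s| ^ (-b) :=
      Real.rpow_le_rpow_of_exponent_ge hs0 hs1 (neg_le_neg hab)
    calc ‖stableKernel δ M w‖ ≤ K * (|s| ^ (-a) + |s| ^ (-b)) :=
          (norm_stableKernel_le hδ.le hw M).trans hle
      _ ≤ K * (|s| ^ (-b) + |s| ^ (-b)) := by gcongr
      _ = 2 * K * |s| ^ (-b) := by ring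
  · have : |s| ^ (-b) ≤ |s| ^ (-a) :=
      Real.rpow_le_rpow_of_exponent_le (not_le.1 hs1).le (neg_le_neg hab)
    calc ‖stableKernel δ M w‖ ≤ δ⁻¹ ^ M * (K * (|s| ^ (-a) + |s| ^ (-b))) ^ (M + 1) :=
          (norm_stableKernel_le_pow hδ hw M).trans (by gcongr)
      _ ≤ δ⁻¹ ^ M * (K * (|s| ^ (-a) + |s| ^ (-a))) ^ (M + 1) := by gcongr
      _ = δ⁻¹ ^ M * (2 * K) ^ (M + 1) * (|s| ^ (-a)) ^ (M + 1) := by ring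
      _ = _ := by rw [← Real.rpow_natCast (|s| ^ _), ← Real.rpow_mul hs0.le, neg_mul]

namespace RegVarLaw
variable {β : ℝ} {p f u : ℕ → ℝ}

theorem renewalSeries (h : RegVarLaw β p f)
    (hu : ∀ n, ∑ k ∈ Finset.range (n + 1), u k * f (n - k) = 1) :
    RenewalSeries (PowerSeries.mk p) (PowerSeries.mk f) (PowerSeries.mk u) := by
  have hlaw : 1 - PowerSeries.mk p = (1 - X) * PowerSeries.mk f := by
    ext n
    rw [sub_mul, one_mul, map_sub, map_sub, coeff_mk, coeff_mk, coeff_one]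
    cases n with
    | zero => simp [h.law_zero, h.tail_zero]
    | succ n => rw [coeff_succ_X_mul, coeff_mk, h.law_succ]; simp
  have hmass : PowerSeries.mk u * PowerSeries.mk f = PowerSeries.mk 1 := by
    ext n
    rw [coeff_mk_mul_mk, hu, coeff_mk, Pi.one_apply]
  refine ⟨fun n => ?_, fun n => ?_, ?_, hlaw, ?_⟩
  · rw [coeff_mk]; exact h.law_nonneg n
  · rw [coeff_mk]; exact (h.tail_pos n).le
  · rw [coeff_mk, h.law_zero]
  · rw [hlaw, mul_left_comm, hmass, mul_comm, mk_one_mul_one_sub_eq_one]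

theorem intervalIntegrable_norm_inv (h : RegVarLaw β p f) :
    IntervalIntegrable (fun t => ‖1 - circleEval (PowerSeries.mk p) t‖⁻¹) volume
      (-Real.pi) Real.pi := by
  have hβ1 := h.index_lt_one
  obtain ⟨K, -, hle⟩ := h.exists_mul_norm_inv_le le_rfl h.index_pos
    (show β < (1 + β) / 2 by linarith)
  have hint : IntervalIntegrable (fun t : ℝ => (f 1)⁻¹ * (K * (1 + |t| ^ (-((1 + β) / 2)))))
      volume (-Real.pi) Real.pi :=
    ((intervalIntegrable_const.add
      (intervalIntegrable_abs_rpow (by linarith) _ _)).const_mul _).const_mul _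
  have hmeas := h.absSummable.continuous_circleEval.measurable
  refine hint.mono_fun' (Measurable.aestronglyMeasurable (by fun_prop)) ?_
  refine (ae_restrict_iff' measurableSet_uIoc).2 ?_
  filter_upwards [Measure.ae_ne volume (0 : ℝ)] with t ht0 ht
  rw [Set.uIoc_of_le (by linarith [Real.pi_pos])] at ht
  have hbound := hle 1 le_rfl t ht0 (by rw [Nat.cast_one, one_mul]; exact abs_le.2 ⟨ht.1.le, ht.2⟩)
  rw [Nat.cast_one, div_one, neg_zero, Real.rpow_zero] at hbound
  rwa [norm_inv, norm_norm, le_inv_mul_iff₀ (h.tail_pos 1)]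

theorem scaledExponent_re_nonneg (h : RegVarLaw β p f) (n : ℕ) (s : ℝ) :
    0 ≤ (scaledExponent p f n s).re := by
  rw [scaledExponent, Complex.div_ofReal_re]
  exact div_nonneg (h.one_sub_circleEval_re_nonneg _) (h.tail_pos n).le

theorem measurable_scaledExponent (h : RegVarLaw β p f) (n : ℕ) :
    Measurable (scaledExponent p f n) := by
  have := h.absSummable.continuous_circleEval.measurable
  unfold scaledExponent
  fun_prop

theorem exists_norm_inv_scaledExponent_le (h : RegVarLaw β p f) {γ γ' : ℝ} (hγ0 : 0 ≤ γ)
    (hγ : γ < β) (hγ' : β < γ') :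
    ∃ K > 0, ∀ n : ℕ, 1 ≤ n → ∀ s : ℝ, s ≠ 0 → |s| ≤ n * Real.pi →
      ‖(scaledExponent p f n s)⁻¹‖ ≤ K * (|s| ^ (-γ) + |s| ^ (-γ')) := by
  obtain ⟨K, hK, hle⟩ := h.exists_mul_norm_inv_le hγ0 hγ hγ'
  refine ⟨K, hK, fun n hn s hs hsn => le_of_eq_of_le ?_ (hle n hn s hs hsn)⟩
  rw [scaledExponent, inv_div, norm_div, Complex.norm_real, Real.norm_of_nonneg (h.tail_pos n).le,
    div_eq_mul_inv]

theorem scaledExponent_ne_zero (h : RegVarLaw β p f) {n : ℕ} (hn : 1 ≤ n) {s : ℝ} (hs : s ≠ 0)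
    (hsn : |s| ≤ n * Real.pi) : scaledExponent p f n s ≠ 0 := by
  have hn0 : (0 : ℝ) < n := by exact_mod_cast hn
  refine div_ne_zero (sub_ne_zero.2 (h.circleEval_ne_one ?_ (div_ne_zero hs hn0.ne')).symm)
    (Complex.ofReal_ne_zero.2 (h.tail_pos n).ne')
  rwa [abs_div, Nat.abs_cast, div_le_iff₀' hn0]

theorem eventually_abs_lt_natCast_mul_pi (s : ℝ) :
    ∀ᶠ n : ℕ in atTop, 1 ≤ n ∧ |s| < n * Real.pi :=
  (eventually_ge_atTop 1).and
    ((tendsto_natCast_atTop_atTop.atTop_mul_const Real.pi_pos).eventually_gt_atTop _)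

theorem ne_zero_of_tendsto_scaledExponent (h : RegVarLaw β p f) {s : ℝ} (hs : s ≠ 0) {l : ℂ}
    (hl : Tendsto (fun n => scaledExponent p f n s) atTop (𝓝 l)) : l ≠ 0 := by
  rintro rfl
  obtain ⟨K, hK, hle⟩ := h.exists_norm_inv_scaledExponent_le le_rfl h.index_pos
    (show β < β + 1 by linarith)
  have _ : 0 < |s| := abs_pos.2 hs
  set B := K * (|s| ^ (-0 : ℝ) + |s| ^ (-(β + 1)))
  have hB : 0 < B := by positivity
  have hlower : B⁻¹ ≤ ‖(0 : ℂ)‖ := by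
    refine ge_of_tendsto hl.norm ?_
    filter_upwards [eventually_abs_lt_natCast_mul_pi s] with n hn
    have hbound := hle n hn.1 s hs hn.2.le
    rw [norm_inv] at hbound
    exact inv_le_of_inv_le₀ (norm_pos_iff.2 (h.scaledExponent_ne_zero hn.1 hs hn.2.le)) hbound
  rw [norm_zero] at hlower
  exact (inv_pos.2 hB).not_ge hlower

theorem tendsto_stableKernel_scaledExponent (h : RegVarLaw β p f) {δ : ℝ} (hδ : 0 ≤ δ) (M : ℕ)
    {s : ℝ} (hs : s ≠ 0) {l : ℂ} (hl : Tendsto (fun n => scaledExponent p f n s) atTop (𝓝 l)) :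
    Tendsto (fun n => stableKernel δ M (scaledExponent p f n s)) atTop
      (𝓝 (stableKernel δ M l)) := by
  have hre : 0 ≤ l.re := ge_of_tendsto' ((Complex.continuous_re.tendsto _).comp hl) fun n =>
    h.scaledExponent_re_nonneg n s
  have hne : 1 + δ * l ≠ 0 := norm_pos_iff.1 (zero_lt_one.trans_le (one_le_norm_one_add_mul hδ hre))
  exact (hl.inv₀ (h.ne_zero_of_tendsto_scaledExponent hs hl)).mul
    ((((hl.const_mul _).const_add _).inv₀ hne).pow M)

theorem exists_tendsto_integral_stableKernel (h : RegVarLaw β p f) {δ : ℝ} (hδ : 0 < δ) {M : ℕ}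
    (hM : 1 < β / 2 * (M + 1 : ℕ)) :
    ∃ l : ℂ, Tendsto (fun n : ℕ => ∫ s in (-(n * Real.pi))..(n * Real.pi),
      stableKernel δ M (scaledExponent p f n s) * Complex.exp (-s * Complex.I)) atTop (𝓝 l) := by
  have hβ0 := h.index_pos
  have hβ1 := h.index_lt_one
  obtain ⟨K, hK, hle⟩ := h.exists_norm_inv_scaledExponent_le (show 0 ≤ β / 2 by linarith)
    (show β / 2 < β by linarith) (show β < (1 + β) / 2 by linarith)
  choose ψ hψ using h.exists_tendsto_scaledExponent
  have hindicator (n : ℕ) (F : ℝ → ℂ) : ∫ s in (-(n * Real.pi))..(n * Real.pi), F s =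
      ∫ s, (Set.Ioc (-(n * Real.pi)) (n * Real.pi)).indicator F s := by
    rw [integral_indicator measurableSet_Ioc,
      intervalIntegral.integral_of_le (neg_le_self (by positivity))]
  simp_rw [hindicator]
  refine ⟨∫ s, stableKernel δ M (ψ s) * Complex.exp (-s * Complex.I),
    tendsto_integral_filter_of_dominated_convergence (fun s => if |s| ≤ 1
      then 2 * K * |s| ^ (-((1 + β) / 2))
      else δ⁻¹ ^ M * (2 * K) ^ (M + 1) * |s| ^ (-(β / 2 * (M + 1 : ℕ)))) ?_ ?_
    (integrable_ite_abs_rpow (by linarith) hM) ?_⟩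
  · refine Eventually.of_forall fun n =>
      (Measurable.aestronglyMeasurable ?_).indicator measurableSet_Ioc
    have := h.measurable_scaledExponent n
    unfold stableKernel
    fun_prop
  · filter_upwards [eventually_ge_atTop 1] with n hn
    filter_upwards [Measure.ae_ne volume (0 : ℝ)] with s hs
    by_cases hmem : s ∈ Set.Ioc (-(n * Real.pi)) (n * Real.pi)
    · rw [Set.indicator_of_mem hmem, norm_mul, ← Complex.ofReal_neg,
        Complex.norm_exp_ofReal_mul_I, mul_one]
      exact norm_stableKernel_le_ite hδ hK.le (by linarith) hs (h.scaledExponent_re_nonneg n s)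
        (hle n hn s hs (abs_le.2 ⟨hmem.1.le, hmem.2⟩)) M
    · rw [Set.indicator_of_notMem hmem, norm_zero]
      split_ifs <;> positivity
  · filter_upwards [Measure.ae_ne volume (0 : ℝ)] with s hs
    refine ((h.tendsto_stableKernel_scaledExponent hδ.le M hs (hψ s)).mul_const _).congr' ?_
    filter_upwards [eventually_abs_lt_natCast_mul_pi s] with n hn
    have hmem : s ∈ Set.Ioc (-(n * Real.pi)) (n * Real.pi) :=
      ⟨(abs_lt.1 hn.2).1, (abs_lt.1 hn.2).2.le⟩
    exact (Set.indicator_of_mem hmem (fun s => stableKernel δ M (scaledExponent p f n s) *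
      Complex.exp (-s * Complex.I))).symm

theorem stableKernel_scaledExponent (h : RegVarLaw β p f) {δ : ℝ} (hδ : δ ≠ 0) (M n : ℕ)
    (s : ℝ) : stableKernel δ M (scaledExponent p f n s) =
      (f n * (f n / δ) ^ M : ℝ) * ((1 - circleEval (PowerSeries.mk p) (s / n))⁻¹ *
        ((f n / δ : ℝ) + (1 - circleEval (PowerSeries.mk p) (s / n)))⁻¹ ^ M) := by
  have hfn : (f n : ℂ) ≠ 0 := Complex.ofReal_ne_zero.2 (h.tail_pos n).ne'
  have hδ' : (δ : ℂ) ≠ 0 := Complex.ofReal_ne_zero.2 hδ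
  rw [stableKernel, scaledExponent]
  set w := 1 - circleEval (PowerSeries.mk p) (s / n)
  have hfactor : (1 + δ * (w / f n) : ℂ) = (f n / δ : ℂ)⁻¹ * ((f n / δ : ℝ) + w) := by
    push_cast
    field_simp
  rw [hfactor, mul_inv, inv_inv, mul_pow, inv_div, div_eq_mul_inv]
  push_cast
  ring

theorem integral_stableKernel (h : RegVarLaw β p f)
    (hu : ∀ n, ∑ k ∈ Finset.range (n + 1), u k * f (n - k) = 1) {δ : ℝ} (hδ : 0 < δ) (M : ℕ)
    {n : ℕ} (hn : 1 ≤ n) :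
    ∫ s in (-(n * Real.pi))..(n * Real.pi),
        stableKernel δ M (scaledExponent p f n s) * Complex.exp (-s * Complex.I) =
      (2 * Real.pi * (n * f n * ((f n / δ) ^ M * coeff n (PowerSeries.mk u *
        discounted (PowerSeries.mk p) (f n / δ) ^ M))) : ℝ) := by
  have hn0 : (0 : ℝ) < n := by exact_mod_cast hn
  have hcoeff := (h.renewalSeries hu).coeff_mass_mul_pow_eq_integral h.absSummable
    h.intervalIntegrable_norm_inv (fun t ht ht0 => h.circleEval_ne_one (by
      rw [Set.uIoc_of_le (by linarith [Real.pi_pos])] at ht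
      exact abs_le.2 ⟨ht.1.le, ht.2⟩) ht0) h.one_sub_circleEval_re_nonneg
      (div_pos (h.tail_pos n) hδ) M n
  have hscale := intervalIntegral.integral_comp_div (a := -(n * Real.pi)) (b := n * Real.pi)
    (fun t : ℝ => (1 - circleEval (PowerSeries.mk p) t)⁻¹ *
      ((f n / δ : ℝ) + (1 - circleEval (PowerSeries.mk p) t))⁻¹ ^ M *
        Complex.exp (-(n * t) * Complex.I)) hn0.ne'
  rw [neg_div, mul_div_cancel_left₀ _ hn0.ne', ← hcoeff] at hscale
  have hphase (s : ℝ) : (-s : ℂ) = -(n * (s / n : ℝ)) := by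
    rw [← Complex.ofReal_natCast, ← Complex.ofReal_mul, mul_div_cancel₀ _ hn0.ne']
  simp_rw [h.stableKernel_scaledExponent hδ.ne', mul_assoc ((f n * _ : ℝ) : ℂ), hphase]
  rw [intervalIntegral.integral_const_mul, hscale, Complex.real_smul]
  push_cast
  ring

theorem exists_tendsto_natCast_mul_coeff (h : RegVarLaw β p f)
    (hu : ∀ n, ∑ k ∈ Finset.range (n + 1), u k * f (n - k) = 1) {δ : ℝ} (hδ : 0 < δ) {M : ℕ}
    (hM : 1 < β / 2 * (M + 1 : ℕ)) :
    ∃ l : ℝ, Tendsto (fun n : ℕ => n * f n * ((f n / δ) ^ M * coeff n (PowerSeries.mk u *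
      discounted (PowerSeries.mk p) (f n / δ) ^ M))) atTop (𝓝 l) := by
  obtain ⟨l, hl⟩ := h.exists_tendsto_integral_stableKernel hδ hM
  refine ⟨_, (((Complex.continuous_re.tendsto _).comp hl).const_mul (2 * Real.pi)⁻¹).congr' ?_⟩
  filter_upwards [eventually_ge_atTop 1] with n hn
  rw [Function.comp_apply, h.integral_stableKernel hu hδ M hn, Complex.ofReal_re,
    inv_mul_cancel_left₀ Real.two_pi_pos.ne']

theorem exists_tendsto_natCast_mul_tail_mul_mass (h : RegVarLaw β p f)
    (hu : ∀ n, ∑ k ∈ Finset.range (n + 1), u k * f (n - k) = 1)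
    {D : ℝ} (hD : 0 ≤ D) (hDoney : ∀ n : ℕ, n * p n ≤ D * f n) :
    ∃ c, Tendsto (fun n : ℕ => n * f n * u n) atTop (𝓝 c) := by
  obtain ⟨M, hM⟩ : ∃ M : ℕ, 1 < β / 2 * (M + 1 : ℕ) := by
    obtain ⟨M, hM⟩ := exists_nat_gt (2 / β)
    have hβ := h.index_pos
    rw [div_lt_iff₀ hβ] at hM
    exact ⟨M, by push_cast; nlinarith⟩
  set S := D * ∑ i ∈ Finset.range M, ((i : ℝ) + 1) with hS
  have hS0 : 0 ≤ S := by positivity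
  refine exists_tendsto_of_forall_norm_sub_le fun ε hε => ?_
  have hδ : 0 < ε / (S + 1) := by positivity
  set δ := ε / (S + 1) with hδ_def
  obtain ⟨l, hl⟩ := h.exists_tendsto_natCast_mul_coeff hu hδ hM
  refine ⟨_, l, hl, Eventually.of_forall fun n => ?_⟩
  have hfn := h.tail_pos n
  have herror := (h.renewalSeries hu).natCast_mul_abs_coeff_mass_sub_le (div_pos hfn hδ) hD
    (fun n => by simpa only [coeff_mk] using hDoney n) M n
  rw [coeff_mk] at herror
  rw [← mul_sub, mul_right_comm, norm_mul, norm_mul, Real.norm_natCast,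
    Real.norm_of_nonneg hfn.le, Real.norm_eq_abs]
  calc _ ≤ D * (f n / δ)⁻¹ * (∑ i ∈ Finset.range M, ((i : ℝ) + 1)) * f n := by gcongr
    _ = S * δ := by rw [hS]; field_simp
    _ ≤ (S + 1) * δ := by gcongr; linarith
    _ = ε := by rw [hδ_def]; field_simp

theorem tendsto_natCast_mul_tail_mul_mass (h : RegVarLaw β p f)
    (hu : ∀ n, ∑ k ∈ Finset.range (n + 1), u k * f (n - k) = 1)
    {D : ℝ} (hD : 0 ≤ D) (hDoney : ∀ n : ℕ, n * p n ≤ D * f n) :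
    Tendsto (fun n : ℕ => n * f n * u n) atTop (𝓝 (Real.Gamma β * Real.Gamma (1 - β))⁻¹) := by
  obtain ⟨c, hc⟩ := h.exists_tendsto_natCast_mul_tail_mul_mass hu hD hDoney
  have hconv := h.regularlyVarying.tendsto_sum_renewal_mul (neg_lt_zero.2 h.index_pos)
    (neg_lt_neg h.index_lt_one) hc
  simp_rw [hu, neg_neg] at hconv
  rwa [eq_inv_of_mul_eq_one_left (tendsto_nhds_unique hconv tendsto_const_nhds)] at hc

end RegVarLaw
end StrongRenewal

/-- `t` is a partial sum of `y`, that is, a renewal time when `y` lists the inter-renewal times.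
The empty sum `0` always is one. -/
def IsPartialSum (y : ℕ → ℕ) (t : ℕ) : Prop := ∃ n, ∑ i ∈ Finset.range n, y i = t

theorem isPartialSum_zero (y : ℕ → ℕ) : IsPartialSum y 0 := ⟨0, by simp⟩

theorem isPartialSum_shift {y : ℕ → ℕ} {n k : ℕ} (hn : ∑ i ∈ Finset.range n, y i = k) (t : ℕ) :
    IsPartialSum (fun i => y (n + i)) t ↔ IsPartialSum y (k + t) := by
  constructor
  · rintro ⟨l, hl⟩
    exact ⟨n + l, by rw [Finset.sum_range_add, hn, hl]⟩
  · rintro ⟨l, hl⟩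
    rcases le_total n l with h | h
    · obtain ⟨r, rfl⟩ := Nat.exists_eq_add_of_le h
      rw [Finset.sum_range_add, hn] at hl
      exact ⟨r, Nat.add_left_cancel hl⟩
    · have : ∑ i ∈ Finset.range l, y i ≤ ∑ i ∈ Finset.range n, y i :=
        Finset.sum_le_sum_of_subset (Finset.range_mono h)
      exact ⟨0, by simp; omega⟩

theorem measurableSet_isPartialSum (t : ℕ) : MeasurableSet {y : ℕ → ℕ | IsPartialSum y t} := by
  have (n : ℕ) : Measurable fun y : ℕ → ℕ => ∑ i ∈ Finset.range n, y i := by fun_prop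
  simp only [IsPartialSum, Set.ofPred_exists]
  exact MeasurableSet.iUnion fun n => this n (measurableSet_singleton t)

section CommonPartialSum
variable {ι : Type*}

/-- `t` is a partial sum of every `y j`, that is, a common renewal time. -/
def IsCommonPartialSum (y : ι → ℕ → ℕ) (t : ℕ) : Prop := ∀ j, IsPartialSum (y j) t

/-- The families of sequences without common partial sum in `[1, N]`. -/
def noCommonPartialSum (ι : Type*) (N : ℕ) : Set (ι → ℕ → ℕ) :=
  {y | ∀ t, 1 ≤ t → t ≤ N → ¬ IsCommonPartialSum y t}

theorem isCommonPartialSum_zero (y : ι → ℕ → ℕ) : IsCommonPartialSum y 0 :=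
  fun j => isPartialSum_zero (y j)

theorem exists_common_shift_mem_noCommonPartialSum {y : ι → ℕ → ℕ} {k N : ℕ} :
    (∃ n : ι → ℕ, (∀ j, ∑ i ∈ Finset.range (n j), y j i = k) ∧
      (fun j i => y j (n j + i)) ∈ noCommonPartialSum ι N) ↔
    IsCommonPartialSum y k ∧ ∀ t, 1 ≤ t → t ≤ N → ¬ IsCommonPartialSum y (k + t) := by
  have hshift {n : ι → ℕ} (hn : ∀ j, ∑ i ∈ Finset.range (n j), y j i = k) (t : ℕ) :
      IsCommonPartialSum (fun j i => y j (n j + i)) t ↔ IsCommonPartialSum y (k + t) :=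
    forall_congr' fun j => isPartialSum_shift (hn j) t
  constructor
  · rintro ⟨n, hn, hE⟩
    exact ⟨fun j => ⟨n j, hn j⟩, fun t h1 h2 => (hshift hn t).not.1 (hE t h1 h2)⟩
  · rintro ⟨hk, hE⟩
    choose n hn using hk
    exact ⟨n, hn, fun t h1 h2 => (hshift hn t).not.2 (hE t h1 h2)⟩

theorem measurableSet_isCommonPartialSum [Countable ι] (t : ℕ) :
    MeasurableSet {y : ι → ℕ → ℕ | IsCommonPartialSum y t} := by
  simp only [IsCommonPartialSum, Set.ofPred_forall]
  have heval (j : ι) : Measurable fun y : ι → ℕ → ℕ => y j := measurable_pi_apply j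
  exact MeasurableSet.iInter fun j => heval j (measurableSet_isPartialSum t)

theorem measurableSet_noCommonPartialSum [Countable ι] (N : ℕ) :
    MeasurableSet (noCommonPartialSum ι N) := by
  simp only [noCommonPartialSum, Set.ofPred_forall]
  exact MeasurableSet.iInter fun t => MeasurableSet.iInter fun _ => MeasurableSet.iInter fun _ =>
    (measurableSet_isCommonPartialSum t).compl

end CommonPartialSum

section LastCommon
variable {Ω ι : Type*}

/-- The event that `k` is a common renewal time of all processes and that there is none in
`(k, k + N]`. -/
def lastCommonSet (Y : ι → ℕ → Ω → ℕ) (k N : ℕ) : Set Ω :=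
  {ω | IsCommonPartialSum (fun j i => Y j i ω) k ∧
    ∀ t, 1 ≤ t → t ≤ N → ¬ IsCommonPartialSum (fun j i => Y j i ω) (k + t)}

theorem lastCommonSet_zero (Y : ι → ℕ → Ω → ℕ) (N : ℕ) :
    lastCommonSet Y 0 N = (fun ω j i => Y j i ω) ⁻¹' noCommonPartialSum ι N := by
  ext ω
  simp only [lastCommonSet, isCommonPartialSum_zero, zero_add, true_and, noCommonPartialSum,
    Set.mem_ofPred_eq, Set.mem_preimage]

theorem pairwiseDisjoint_lastCommonSet (Y : ι → ℕ → Ω → ℕ) (n : ℕ) :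
    (Finset.range (n + 1) : Set ℕ).PairwiseDisjoint fun k => lastCommonSet Y k (n - k) := by
  have hlt {a b : ℕ} (hab : a < b) (hb : b ≤ n) :
      Disjoint (lastCommonSet Y a (n - a)) (lastCommonSet Y b (n - b)) :=
    Set.disjoint_left.2 fun ω ha hb' => ha.2 (b - a) (by omega) (by omega) <| by
      rw [Nat.add_sub_cancel' hab.le]
      exact hb'.1
  intro a ha b hb hab
  rw [Finset.mem_coe, Finset.mem_range, Nat.lt_succ_iff] at ha hb
  exact hab.lt_or_gt.elim (hlt · hb) fun h => (hlt h ha).symm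

theorem iUnion_lastCommonSet (Y : ι → ℕ → Ω → ℕ) (n : ℕ) :
    ⋃ k ∈ Finset.range (n + 1), lastCommonSet Y k (n - k) = Set.univ := by
  classical
  refine Set.eq_univ_of_forall fun ω => ?_
  set P : ℕ → Prop := IsCommonPartialSum fun j i => Y j i ω
  have hle := Nat.findGreatest_le (P := P) n
  have hspec : P (Nat.findGreatest P n) :=
    Nat.findGreatest_spec n.zero_le (isCommonPartialSum_zero _)
  simp only [Set.mem_iUnion]
  exact ⟨Nat.findGreatest P n, Finset.mem_range.2 (by omega), hspec, fun t h1 h2 =>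
    Nat.findGreatest_is_greatest (P := P) (n := n) (by omega) (by omega)⟩

end LastCommon

section RenewalProperty
variable {Ω : Type*} [MeasurableSpace Ω] {μ : Measure Ω}

theorem IsRenewalProcess.measurable_seq {X : ℕ → Ω → ℕ} (h : IsRenewalProcess μ X) :
    Measurable fun ω n => X n ω := measurable_pi_iff.2 h.measurable

theorem IsRenewalProcess.sum_strictMono {X : ℕ → Ω → ℕ} (h : IsRenewalProcess μ X) (ω : Ω) :
    StrictMono fun n => ∑ i ∈ Finset.range n, X i ω :=
  strictMono_nat_of_lt_succ fun n => by
    have := h.pos n ω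
    rw [Finset.sum_range_succ]
    omega

theorem IsRenewalProcess.identDistrib_shift {X : ℕ → Ω → ℕ} (h : IsRenewalProcess μ X) (n : ℕ) :
    IdentDistrib (fun ω i => X (n + i) ω) (fun ω i => X i ω) μ μ :=
  IdentDistrib.pi (fun i => (h.identDistrib (n + i)).trans (h.identDistrib i).symm)
    (h.indep.precomp (add_right_injective n)) h.indep

variable {ι : Type*} {Y : ι → ℕ → Ω → ℕ}

theorem measurable_seq_family (hY : ∀ j, IsRenewalProcess μ (Y j)) :
    Measurable fun ω j i => Y j i ω :=
  measurable_pi_iff.2 fun j => (hY j).measurable_seq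

theorem identDistrib_shift_family [Countable ι] (hY : ∀ j, IsRenewalProcess μ (Y j))
    (hindep : iIndepFun (fun j ω i => Y j i ω) μ) (n : ι → ℕ) :
    IdentDistrib (fun ω j i => Y j (n j + i) ω) (fun ω j i => Y j i ω) μ μ :=
  IdentDistrib.pi (fun j => (hY j).identDistrib_shift (n j))
    (hindep.comp (fun j y i => y (n j + i)) fun j =>
      measurable_pi_iff.2 fun i => measurable_pi_apply (n j + i)) hindep

theorem indepFun_sum_range_shift (hY : ∀ j, IsRenewalProcess μ (Y j))
    (hindep : iIndepFun (fun j ω i => Y j i ω) μ) (n : ι → ℕ) :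
    IndepFun (fun ω j => ∑ i ∈ Finset.range (n j), Y j i ω) (fun ω j i => Y j (n j + i) ω) μ := by
  have hpairs := iIndepFun_uncurry' (fun j => (hY j).measurable) hindep fun j => (hY j).indep
  have hsplit := indep_iSup_of_disjoint (fun q : ι × ℕ => ((hY q.1).measurable q.2).comap_le)
    hpairs.iIndep (S := {q | q.2 < n q.1}) (T := {q | n q.1 ≤ q.2})
    (Set.disjoint_left.2 fun q (hq : q.2 < n q.1) => hq.not_ge)
  refine (IndepFun_iff_Indep _ _ _).2
    (indep_of_indep_of_le_left (indep_of_indep_of_le_right hsplit ?_) ?_) <;>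
    rw [← measurable_iff_comap_le]
  · refine @measurable_pi_lambda _ _ _ (_) _ _ fun j => @measurable_pi_lambda _ _ _ (_) _ _
      fun i => (comap_measurable (Y j (n j + i))).mono ?_ le_rfl
    exact le_iSup₂_of_le (j, n j + i) (Nat.le_add_right _ _) le_rfl
  · refine @measurable_pi_lambda _ _ _ (_) _ _ fun j => Finset.measurable_sum _ fun i hi =>
      (comap_measurable (Y j i)).mono ?_ le_rfl
    exact le_iSup₂_of_le (j, i) (Finset.mem_range.1 hi) le_rfl

theorem measure_isCommonPartialSum_and_shift_mem [Finite ι] (hY : ∀ j, IsRenewalProcess μ (Y j))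
    (hindep : iIndepFun (fun j ω i => Y j i ω) μ) (k : ℕ) {E : Set (ι → ℕ → ℕ)}
    (hE : MeasurableSet E) :
    μ {ω | ∃ n : ι → ℕ, (∀ j, ∑ i ∈ Finset.range (n j), Y j i ω = k) ∧
        (fun j i => Y j (n j + i) ω) ∈ E} =
      μ {ω | IsCommonPartialSum (fun j i => Y j i ω) k} *
        μ ((fun ω j i => Y j i ω) ⁻¹' E) := by
  set A : (ι → ℕ) → Set Ω := fun n =>
    (fun ω j => ∑ i ∈ Finset.range (n j), Y j i ω) ⁻¹' {fun _ => k}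
  have hA (n ω) : ω ∈ A n ↔ ∀ j, ∑ i ∈ Finset.range (n j), Y j i ω = k := funext_iff
  have hAm (n) : MeasurableSet (A n) :=
    measurable_pi_iff.2 (fun j => Finset.measurable_sum _ fun i _ => (hY j).measurable i)
      (measurableSet_singleton _)
  have hshift (n : ι → ℕ) : Measurable fun ω j i => Y j (n j + i) ω :=
    measurable_pi_iff.2 fun j => measurable_pi_iff.2 fun i => (hY j).measurable (n j + i)
  have hdisj : Pairwise (Function.onFun Disjoint A) := fun a b hab =>
    Set.disjoint_left.2 fun ω ha hb => hab <| funext fun j =>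
      ((hY j).sum_strictMono ω).injective (((hA a ω).1 ha j).trans ((hA b ω).1 hb j).symm)
  have hcommon : {ω | IsCommonPartialSum (fun j i => Y j i ω) k} = ⋃ n, A n := by
    ext ω
    simp only [Set.mem_ofPred_eq, Set.mem_iUnion, hA]
    exact Classical.skolem
  have hrestart : {ω | ∃ n : ι → ℕ, (∀ j, ∑ i ∈ Finset.range (n j), Y j i ω = k) ∧
      (fun j i => Y j (n j + i) ω) ∈ E} = ⋃ n, A n ∩ (fun ω j i => Y j (n j + i) ω) ⁻¹' E := by
    ext ω
    simp only [Set.mem_ofPred_eq, Set.mem_iUnion, Set.mem_inter_iff, hA, Set.mem_preimage]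
  rw [hrestart, hcommon, measure_iUnion hdisj hAm, ← ENNReal.tsum_mul_right, measure_iUnion
    (fun a b hab => (hdisj hab).mono Set.inter_subset_left Set.inter_subset_left)
    fun n => (hAm n).inter (hshift n hE)]
  refine tsum_congr fun n => ?_
  rw [(indepFun_sum_range_shift hY hindep n).measure_inter_preimage_eq_mul _ _
    (measurableSet_singleton _) hE,
    (identDistrib_shift_family hY hindep n).measure_preimage_eq hE]

theorem measurableSet_lastCommonSet [Countable ι] (hY : ∀ j, IsRenewalProcess μ (Y j)) (k N : ℕ) :
    MeasurableSet (lastCommonSet Y k N) := by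
  have hmeas (t : ℕ) : MeasurableSet {ω | IsCommonPartialSum (fun j i => Y j i ω) t} :=
    measurable_seq_family hY (measurableSet_isCommonPartialSum t)
  simp only [lastCommonSet, Set.ofPred_and, Set.ofPred_forall]
  exact (hmeas k).inter <| MeasurableSet.iInter fun t => MeasurableSet.iInter fun _ =>
    MeasurableSet.iInter fun _ => (hmeas (k + t)).compl

variable [Fintype ι]

theorem measure_isCommonPartialSum (hindep : iIndepFun (fun j ω i => Y j i ω) μ) (k : ℕ) :
    μ {ω | IsCommonPartialSum (fun j i => Y j i ω) k} =
      ∏ j, μ {ω | IsPartialSum (fun i => Y j i ω) k} := by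
  simp only [IsCommonPartialSum, Set.ofPred_forall]
  exact hindep.meas_iInter fun j => ⟨_, measurableSet_isPartialSum k, rfl⟩

theorem measureReal_lastCommonSet (hY : ∀ j, IsRenewalProcess μ (Y j))
    (hindep : iIndepFun (fun j ω i => Y j i ω) μ) (k N : ℕ) :
    μ.real (lastCommonSet Y k N) =
      (∏ j, μ.real {ω | IsPartialSum (fun i => Y j i ω) k}) * μ.real (lastCommonSet Y 0 N) := by
  have hset : lastCommonSet Y k N =
      {ω | ∃ n : ι → ℕ, (∀ j, ∑ i ∈ Finset.range (n j), Y j i ω = k) ∧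
        (fun j i => Y j (n j + i) ω) ∈ noCommonPartialSum ι N} :=
    Set.ext fun ω => exists_common_shift_mem_noCommonPartialSum.symm
  simp only [Measure.real]
  rw [hset, lastCommonSet_zero, measure_isCommonPartialSum_and_shift_mem hY hindep k
    (measurableSet_noCommonPartialSum N), measure_isCommonPartialSum hindep,
    ENNReal.toReal_mul, ENNReal.toReal_prod]

theorem sum_prod_isPartialSum_mul_lastCommonSet [IsProbabilityMeasure μ]
    (hY : ∀ j, IsRenewalProcess μ (Y j)) (hindep : iIndepFun (fun j ω i => Y j i ω) μ) (n : ℕ) :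
    ∑ k ∈ Finset.range (n + 1), (∏ j, μ.real {ω | IsPartialSum (fun i => Y j i ω) k}) *
      μ.real (lastCommonSet Y 0 (n - k)) = 1 := by
  simp_rw [← measureReal_lastCommonSet hY hindep]
  rw [← measureReal_biUnion_finset (pairwiseDisjoint_lastCommonSet Y n)
    fun k _ => measurableSet_lastCommonSet hY k _, iUnion_lastCommonSet, probReal_univ]

end RenewalProperty

theorem mem_commonRenewals_iff {Ω : Type*} {m : ℕ} {Y : Fin m → ℕ → Ω → ℕ} {ω : Ω} {t : ℕ} :
    t ∈ commonRenewals Y ω ↔ 1 ≤ t ∧ IsCommonPartialSum (fun j i => Y j i ω) t := by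
  refine and_congr_right fun ht => forall_congr' fun j => ⟨?_, ?_⟩
  · rintro ⟨n, _, hn⟩
    exact ⟨n, hn.symm⟩
  · rintro ⟨n, hn⟩
    refine ⟨n, Nat.one_le_iff_ne_zero.2 ?_, hn.symm⟩
    rintro rfl
    simp only [Finset.range_zero, Finset.sum_empty] at hn
    omega

theorem lastCommonSet_zero_eq_interGap {Ω : Type*} {m : ℕ} (Y : Fin m → ℕ → Ω → ℕ) (N : ℕ) :
    lastCommonSet Y 0 N = {ω | (N : ℕ∞) < interGap Y 0 ω} := by
  ext ω
  simp only [lastCommonSet, Set.mem_ofPred_eq, isCommonPartialSum_zero, true_and, interGap,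
    interTime, nextGap, zero_add, Nat.cast_inj, exists_eq_right]
  constructor
  · intro hnone
    refine (Nat.cast_lt.2 N.lt_succ_self).trans_le (le_sInf ?_)
    rintro _ ⟨l, rfl, hl, hmem⟩
    exact Nat.cast_le.2 (not_le.1 fun hN => hnone l hl hN (mem_commonRenewals_iff.1 hmem).2)
  · intro hlt t h1 h2 hall
    exact (Nat.cast_lt.1 (hlt.trans_le
      (sInf_le ⟨t, rfl, h1, mem_commonRenewals_iff.2 ⟨h1, hall⟩⟩))).not_ge h2

theorem lastCommonSet_zero_eq_tail {Ω : Type*} [MeasurableSpace Ω] {μ : Measure Ω}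
    {X : ℕ → Ω → ℕ} (h : IsRenewalProcess μ X) (N : ℕ) :
    lastCommonSet (fun _ : Unit => X) 0 N = {ω | N < X 0 ω} := by
  ext ω
  simp only [lastCommonSet, Set.mem_ofPred_eq, zero_add, IsCommonPartialSum, forall_const,
    isPartialSum_zero, true_and]
  constructor
  · intro hnone
    by_contra hle
    exact hnone (X 0 ω) (h.pos 0 ω) (not_lt.1 hle) ⟨1, by simp⟩
  · rintro hlt t ht htN ⟨n, hn⟩
    cases n with
    | zero =>
      simp only [Finset.range_zero, Finset.sum_empty] at hn
      omega
    | succ n =>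
      rw [Finset.sum_range_succ'] at hn
      omega

section RenewalMass
variable {Ω : Type*} [MeasurableSpace Ω] {μ : Measure Ω} {X : ℕ → Ω → ℕ}

theorem tail_antitone [IsFiniteMeasure μ] : Antitone (tail μ X) := fun _ _ hle =>
  measureReal_mono fun _ hω => hle.trans_lt hω

theorem mass_succ [IsFiniteMeasure μ] (hX : Measurable (X 0)) (n : ℕ) :
    mass μ X (n + 1) = tail μ X n - tail μ X (n + 1) := by
  have hset : {ω | X 0 ω = n + 1} = {ω | n < X 0 ω} \ {ω | n + 1 < X 0 ω} := by
    ext ω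
    simp only [Set.mem_ofPred_eq, Set.mem_sdiff]
    omega
  have hsub : {ω | n + 1 < X 0 ω} ⊆ {ω | n < X 0 ω} := fun ω hω => n.lt_succ_self.trans hω
  rw [mass, hset, measureReal_sdiff hsub (hX measurableSet_Ioi), tail, tail]

theorem IsRenewalProcess.mass_zero (h : IsRenewalProcess μ X) : mass μ X 0 = 0 := by
  have hempty : {ω | X 0 ω = 0} = ∅ :=
    Set.eq_empty_of_forall_notMem fun ω => Nat.one_le_iff_ne_zero.1 (h.pos 0 ω)
  rw [mass, hempty, measureReal_empty]

theorem IsRenewalProcess.tail_zero [IsProbabilityMeasure μ] (h : IsRenewalProcess μ X) :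
    tail μ X 0 = 1 := by
  have huniv : {ω | 0 < X 0 ω} = Set.univ := Set.eq_univ_of_forall fun ω => h.pos 0 ω
  rw [tail, huniv, probReal_univ]

section
variable {β : ℝ} {L : ℕ → ℝ}

theorem tail_pos_of_slowlyVarying [IsFiniteMeasure μ] (hL : SlowlyVarying L)
    (htail : ∀ n : ℕ, 1 ≤ n → tail μ X n = (n : ℝ) ^ (-β) * L n) (n : ℕ) : 0 < tail μ X n := by
  obtain ⟨k, hLk, hk1, hnk⟩ :=
    (hL.eventually_pos.and ((eventually_ge_atTop 1).and (eventually_ge_atTop n))).exists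
  refine lt_of_lt_of_le ?_ (tail_antitone hnk)
  rw [htail k hk1]
  exact mul_pos (Real.rpow_pos_of_pos (by exact_mod_cast hk1) _) hLk

theorem regularlyVarying_tail [IsFiniteMeasure μ] (hL : SlowlyVarying L)
    (htail : ∀ n : ℕ, 1 ≤ n → tail μ X n = (n : ℝ) ^ (-β) * L n) :
    RegularlyVarying (-β) (tail μ X) := by
  refine .of_antitone (tail_pos_of_slowlyVarying hL htail) tail_antitone fun c hc => ?_
  have hlim := ((tendsto_floor_mul_div hc.le).rpow_const (p := -β) (Or.inl hc.ne')).mul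
    (hL.tendsto_ratio c hc)
  rw [mul_one] at hlim
  refine hlim.congr' ?_
  filter_upwards [eventually_ge_atTop 1, (tendsto_floor_mul_atTop hc).eventually_ge_atTop 1]
    with n hn hk
  rw [htail n hn, htail _ hk, mul_comm c, Real.div_rpow (Nat.cast_nonneg _) (Nat.cast_nonneg _),
    mul_div_mul_comm]

theorem IsRenewalProcess.regVarLaw [IsProbabilityMeasure μ] (h : IsRenewalProcess μ X)
    (hap : Aperiodic μ X) (hβ : β ∈ Set.Ioo (0 : ℝ) 1) (hL : SlowlyVarying L)
    (htail : ∀ n : ℕ, 1 ≤ n → tail μ X n = (n : ℝ) ^ (-β) * L n) :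
    RegVarLaw β (mass μ X) (tail μ X) where
  index_pos := hβ.1
  index_lt_one := hβ.2
  law_zero := h.mass_zero
  law_succ := mass_succ (h.measurable 0)
  tail_zero := h.tail_zero
  antitone := tail_antitone
  regularlyVarying := regularlyVarying_tail hL htail
  aperiodic := hap

theorem IsRenewalProcess.tendsto_natCast_mul_tail_mul_renewal_mass [IsProbabilityMeasure μ]
    (h : IsRenewalProcess μ X) (hlaw : RegVarLaw β (mass μ X) (tail μ X))
    (hDoney : DoneyCondition μ X) :
    Tendsto (fun n : ℕ => n * tail μ X n * μ.real {ω | IsPartialSum (fun i => X i ω) n}) atTop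
      (𝓝 (Real.Gamma β * Real.Gamma (1 - β))⁻¹) := by
  obtain ⟨D, hD⟩ := hDoney
  refine hlaw.tendsto_natCast_mul_tail_mul_mass (fun n => ?_) (le_max_right D 0) fun n => ?_
  · simpa only [Finset.univ_unique, Finset.prod_singleton, lastCommonSet_zero_eq_tail h, tail] using
      sum_prod_isPartialSum_mul_lastCommonSet (Y := fun _ : Unit => X) (fun _ => h)
        iIndepFun.of_subsingleton n
  · have hDn := (div_le_iff₀ (hlaw.tail_pos n)).1 (hD ⟨n, rfl⟩)
    exact hDn.trans (mul_le_mul_of_nonneg_right (le_max_left _ _) (hlaw.tail_pos n).le)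

end

end RenewalMass

section Intersection
variable {Ω : Type*} [MeasurableSpace Ω] {μ : Measure Ω} {m : ℕ} {Y : Fin m → ℕ → Ω → ℕ}
  {β : Fin m → ℝ}

theorem Gamma_mul_Gamma_one_sub_pos {s : ℝ} (hs : s ∈ Set.Ioo (0 : ℝ) 1) :
    0 < Real.Gamma s * Real.Gamma (1 - s) :=
  mul_pos (Real.Gamma_pos_of_pos hs.1) (Real.Gamma_pos_of_pos (sub_pos.2 hs.2))

/-- The function `g` of index `-β*` for which the renewal mass of the intersection process is
asymptotic to `1 / (n g(n))`. -/
noncomputable def interScale (μ : Measure Ω) (Y : Fin m → ℕ → Ω → ℕ) (β : Fin m → ℝ) (n : ℕ) : ℝ :=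
  (n : ℝ) ^ ((m : ℝ) - 1) * ∏ j, Real.Gamma (β j) * Real.Gamma (1 - β j) * tail μ (Y j) n

theorem regularlyVarying_interScale (hβ : ∀ j, β j ∈ Set.Ioo (0 : ℝ) 1)
    (hreg : ∀ j, RegularlyVarying (-β j) (tail μ (Y j))) :
    RegularlyVarying (-betaStar β) (interScale μ Y β) :=
  ((RegularlyVarying.rpow ((m : ℝ) - 1)).mul (RegularlyVarying.prod Finset.univ fun j _ =>
    (hreg j).const_mul (Gamma_mul_Gamma_one_sub_pos (hβ j)))).congr
    (by rw [betaStar, Finset.sum_neg_distrib]; ring) fun _ _ => rfl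

theorem natCast_mul_interScale {n : ℕ} (hn : 1 ≤ n) :
    n * interScale μ Y β n =
      ∏ j, Real.Gamma (β j) * Real.Gamma (1 - β j) * (n * tail μ (Y j) n) := by
  have hn0 : (0 : ℝ) < n := by exact_mod_cast hn
  have hpow : (n : ℝ) * (n : ℝ) ^ ((m : ℝ) - 1) = (n : ℝ) ^ m := by
    rw [Real.rpow_sub_one hn0.ne', mul_div_cancel₀ _ hn0.ne', Real.rpow_natCast]
  simp only [mul_left_comm _ (n : ℝ)]
  rw [Finset.prod_mul_distrib, Finset.prod_const, Finset.card_univ, Fintype.card_fin, ← hpow,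
    interScale, mul_assoc]

theorem tendsto_natCast_mul_interScale_mul_prod [IsProbabilityMeasure μ]
    (hY : ∀ j, IsRenewalProcess μ (Y j))
    (hlaw : ∀ j, RegVarLaw (β j) (mass μ (Y j)) (tail μ (Y j)))
    (hDoney : ∀ j, DoneyCondition μ (Y j)) :
    Tendsto (fun n : ℕ => n * interScale μ Y β n *
      ∏ j, μ.real {ω | IsPartialSum (fun i => Y j i ω) n}) atTop (𝓝 1) := by
  have hlim := tendsto_finsetProd Finset.univ fun j _ =>
    ((hY j).tendsto_natCast_mul_tail_mul_renewal_mass (hlaw j) (hDoney j)).const_mul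
      (Real.Gamma (β j) * Real.Gamma (1 - β j))
  have hne (j) : Real.Gamma (β j) * Real.Gamma (1 - β j) ≠ 0 :=
    (Gamma_mul_Gamma_one_sub_pos ⟨(hlaw j).index_pos, (hlaw j).index_lt_one⟩).ne'
  simp only [mul_inv_cancel₀ (hne _), Finset.prod_const_one] at hlim
  refine hlim.congr' ?_
  filter_upwards [eventually_ge_atTop 1] with n hn
  rw [natCast_mul_interScale hn, ← Finset.prod_mul_distrib]
  exact Finset.prod_congr rfl fun j _ => (mul_assoc _ _ _).symm

theorem rpow_mul_LStar_eq {L : Fin m → ℕ → ℝ} {n : ℕ} (hn : 1 ≤ n)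
    (htail : ∀ j, tail μ (Y j) n = (n : ℝ) ^ (-β j) * L j n) :
    (n : ℝ) ^ (-betaStar β) * LStar β L n =
      (Real.Gamma (betaStar β) * Real.Gamma (1 - betaStar β))⁻¹ * interScale μ Y β n := by
  have hn0 : (0 : ℝ) < n := by exact_mod_cast hn
  have hpow : (n : ℝ) ^ (-betaStar β) = (n : ℝ) ^ ((m : ℝ) - 1) * ∏ j, (n : ℝ) ^ (-β j) := by
    rw [← Real.rpow_sum_of_pos hn0, ← Real.rpow_add hn0, betaStar, Finset.sum_neg_distrib]
    congr 1
    ring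
  simp only [interScale, htail, mul_left_comm (_ * _) ((n : ℝ) ^ (_ : ℝ))]
  rw [Finset.prod_mul_distrib, hpow, LStar]
  ring

theorem interTail_antitone [IsFiniteMeasure μ] : Antitone (interTail μ Y) := fun _ _ hle =>
  measureReal_mono fun ω (hω : _ < interGap Y 0 ω) => (Nat.cast_le.2 hle).trans_lt hω

theorem sum_prod_isPartialSum_mul_interTail [IsProbabilityMeasure μ]
    (hY : ∀ j, IsRenewalProcess μ (Y j))
    (hindep : iIndepFun (fun (j : Fin m) (ω : Ω) (n : ℕ) => Y j n ω) μ) (n : ℕ) :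
    ∑ k ∈ Finset.range (n + 1), (∏ j, μ.real {ω | IsPartialSum (fun i => Y j i ω) k}) *
      interTail μ Y (n - k) = 1 := by
  simpa only [lastCommonSet_zero_eq_interGap, interTail] using
    sum_prod_isPartialSum_mul_lastCommonSet hY hindep n

end Intersection

end Renewal

theorem lemmaA1 {Ω : Type*} [MeasurableSpace Ω] (μ : Measure Ω) [IsProbabilityMeasure μ]
    {m : ℕ} (Y : Fin m → ℕ → Ω → ℕ) (β : Fin m → ℝ) (L : Fin m → ℕ → ℝ)
    (hY : ∀ j, Renewal.IsRenewalProcess μ (Y j))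
    (hindep : iIndepFun (fun (j : Fin m) (ω : Ω) (n : ℕ) => Y j n ω) μ)
    (hap : ∀ j, Renewal.Aperiodic μ (Y j))
    (hβ : ∀ j, β j ∈ Set.Ioo (0 : ℝ) 1)
    (hL : ∀ j, Renewal.SlowlyVarying (L j))
    (htail : ∀ j, ∀ n : ℕ, 1 ≤ n → Renewal.tail μ (Y j) n = (n : ℝ) ^ (-β j) * L j n)
    (hDoney : ∀ j, Renewal.DoneyCondition μ (Y j))
    (hβstar : Renewal.betaStar β ∈ Set.Ioo (0 : ℝ) 1) :
    Renewal.interTail μ Y ~[atTop]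
      fun n : ℕ => (n : ℝ) ^ (-Renewal.betaStar β) * Renewal.LStar β L n := by
  open Renewal in
  have hlaw := fun j => (hY j).regVarLaw (hap j) (hβ j) (hL j) (htail j)
  have hscale := regularlyVarying_interScale hβ fun j => (hlaw j).regularlyVarying
  have hlim : Tendsto (fun n => interTail μ Y n / interScale μ Y β n) atTop
      (𝓝 (Real.Gamma (betaStar β) * Real.Gamma (1 - betaStar β))⁻¹) := by
    simpa only [neg_neg] using hscale.tendsto_tail (by linarith [hβstar.1])
      (by linarith [hβstar.2]) (tendsto_natCast_mul_interScale_mul_prod hY hlaw hDoney)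
      interTail_antitone (fun _ => measureReal_nonneg)
      (sum_prod_isPartialSum_mul_interTail hY hindep)
  have hB := (Gamma_mul_Gamma_one_sub_pos hβstar).ne'
  have hone := hlim.mul_const (Real.Gamma (betaStar β) * Real.Gamma (1 - betaStar β))
  rw [inv_mul_cancel₀ hB] at hone
  refine isEquivalent_of_tendsto_one (hone.congr' ?_)
  filter_upwards [eventually_ge_atTop 1] with n hn
  rw [Pi.div_apply, rpow_mul_LStar_eq hn fun j => htail j n hn, inv_mul_eq_div, div_div_eq_mul_div,
    div_mul_eq_mul_div]
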